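/- Notation. Let $(a)_n=a(a+1)\cdots(a+n-1)$. For $\mu,\nu\in\mathbb{C}$ and real $x>0$ let $$P_\nu^{-\mu}(x)=\frac{2^{-\nu}|1-x|^{\mu/2}}{\Gamma(1+\mu)(1+x)^{\mu/2-\nu}}\,F\Big(-\nu,\mu-\nu;1+\mu;\frac{x-1}{x+1}\Big)$$ (where $F(a,b;c;w)/\Gamma(c)=\sum_k (a)_k(b)_k w^k/(\Gamma(c+k)k!)$ is entire in $c$) be the Ferrers function ($x<1$), respectively the associated Legendre function ($x>1$), of the first kind. Let $$g_n(\tau,r)=(-1)^n\sum_{k=0}^n\frac{(-r-\tau)_{n-k}}{(n-k)!}\frac{(\tau)_k}{k!}(-1)^k=\frac{(-1)^n(-r-\tau)_n}{n!}F(-n,\tau;1+\tau+r-n;-1)$$ be the Bateman polynomials, and let $$\mathfrak p_n(\rho,\tau,t)=\frac{t^n(\rho)_n}{n!}\,{}_3F_2\Big({-n,\ \tfrac{\tau}{2},\ \tfrac{\tau+1}{2}\atop \tau+1,\ 1-\rho-n};\frac1t\Big)=\sum_{k=0}^n\frac{(\rho)_{n-k}t^{n-k}}{(n-k)!}\,c_k(\tau),\qquad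 c_k(\tau)=\frac{(\tau/2)_k((\tau+1)/2)_k}{(\tau+1)_k\,k!},$$ be the Clausen polynomials (all of these are polynomials in their parameters, removable singularities being removed; $c_0=1$). Theorem. Let $\mu,\nu\in\mathbb{C}$. There are two pairs of mutually inverse series; each of them converges absolutely to its left-hand side. 1. If $x\in(2^{-1/2},1)$, or $x=2^{-1/2}$ and $\operatorname{Re}\nu>-2/3$, or $x\in(0,1)$ and $\nu-\mu\in\mathbb{N}_0$, then $$\frac{P_\nu^{-\mu}(x)}{(1+x)^\mu}=\sum_{n=0}^\infty\frac{(-1)^n(\mu-\nu)_n\,\mathfrak p_n(-\frac\nu2,2\mu,1)}{2^{\mu-n}x^{n+\mu-\nu}(1-x^2)^{-n/2}}\,P_{\nu-\mu-n}^{-\mu-n}\Big(\frac1x\Big),$$ and if $x\in(0,1)$, then $$\frac{P_{\nu-\mu}^{-\mu}(1/x)}{2^\mu x^{\mu-\nu}}=\sum_{n=0}^\infty(-1)^n(\mu-\nu)_n\,g_n(\nu,-2\mu)\,\frac{(1-x)^{n/2}P_\nu^{-\mu-n}(x)}{(1+x)^{n/2+\mu}}.$$ 2. If $x\in(0,1)$,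 then $$\frac{x^\nu P_\nu^{-\mu}(1/x)}{(1+x)^\mu}=\sum_{n=0}^\infty\frac{(\mu-\nu)_n\,\mathfrak p_n(-\frac\nu2,2\mu,1)}{2^{\mu-n}(1-x^2)^{-n/2}}\,P_{\nu-\mu-n}^{-n-\mu}(x),$$ $$\frac{P_{\nu-\mu}^{-\mu}(x)}{2^\mu x^\nu}=\sum_{n=0}^\infty(\mu-\nu)_n\,g_n(\nu,-2\mu)\,\frac{(1-x)^{n/2}P_\nu^{-n-\mu}(1/x)}{(1+x)^{n/2+\mu}}.$$ Mutual inverseness means that, for all $n\ge0$, $$\sum_{k=0}^n4^k\,\mathfrak p_k(-\tfrac\nu2,2\mu,1)\,g_{n-k}(\nu,-2(\mu+k))=\delta_{n,0}=\sum_{k=0}^n g_k(\nu,-2\mu)\,4^{n-k}\,\mathfrak p_{n-k}(-\tfrac\nu2,2(\mu+k),1).$$ -/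

import Mathlib

noncomputable section

/-- The Pochhammer symbol `(a)_n = a (a + 1) ⋯ (a + n - 1)`. -/
abbrev poch (a : ℂ) (n : ℕ) : ℂ := (ascPochhammer ℂ n).eval a

/-- The regularized Gauss function `F(a, b; c; w) / Γ(c)`, as the series
`∑ (a)_k (b)_k / Γ(c + k) * w ^ k / k!`, for `|w| < 1`.  As `Complex.Gamma` takes the value `0` at
its poles, `(Γ (c + k))⁻¹` is the entire reciprocal Gamma function and `c` is arbitrary. -/
def regHyp (a b c w : ℂ) : ℂ :=
  ∑' k : ℕ, poch a k * poch b k * (Complex.Gamma (c + k))⁻¹ * (w ^ k / (k.factorial : ℂ))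

/-- The Legendre function of the first kind `P_ν^κ(x)` of degree `ν` and order `κ`, for real
`x > 0`: the Ferrers function for `0 < x < 1`, the associated Legendre function for `x > 1`.
With `κ = -μ` this is
`2^{-ν} |1-x|^{μ/2} (1+x)^{ν-μ/2} F(-ν, μ-ν; 1+μ; (x-1)/(x+1)) / Γ(1+μ)`. -/
def legendreFun (ν κ : ℂ) (x : ℝ) : ℂ :=
  (2 : ℂ) ^ (-ν) * ((|1 - x| : ℝ) : ℂ) ^ (-κ / 2) * ((1 + x : ℝ) : ℂ) ^ (ν + κ / 2) *
    regHyp (-ν) (-κ - ν) (1 - κ) (((x - 1) / (x + 1) : ℝ) : ℂ)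

/-- The hypergeometric polynomials
`g_n(τ, ρ, s) = (ρ-τ)_n / n! * F(-n, τ; 1+τ-ρ-n; 1-s)` written without the removable
singularities; they are the Taylor coefficients of `(1-z)^{τ-ρ} (1-(1-s)z)^{-τ}`. -/
def gaussPoly (n : ℕ) (τ ρ s : ℂ) : ℂ :=
  ∑ k ∈ Finset.range (n + 1),
    poch (ρ - τ) (n - k) / ((n - k).factorial : ℂ) * (poch τ k / (k.factorial : ℂ)) * (1 - s) ^ k

/-- The Bateman polynomials `g_n(τ, r) = (-1)^n g_n(τ, -r, 2)`. -/
def batemanPoly (n : ℕ) (τ r : ℂ) : ℂ := (-1) ^ n * gaussPoly n τ (-r) 2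

/-- `(τ/2)_k ((τ+1)/2)_k / ((τ+1)_k k!)`, a polynomial in `τ`. -/
def sqrtCoeff (τ : ℂ) : ℕ → ℂ
  | 0 => 1
  | k + 1 => τ * poch (τ + k + 2) k / (4 ^ (k + 1) * ((k + 1).factorial : ℂ))

/-- The polynomials `𝔭_n(ρ, τ, t)`, that is
`(ρ)_n t^n / n! * ₃F₂(-n, τ/2, (τ+1)/2; τ+1, 1-ρ-n; 1/t)`
written without the removable singularities. -/
def clausenPoly (n : ℕ) (ρ τ t : ℂ) : ℂ :=
  ∑ k ∈ Finset.range (n + 1),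
    poch ρ (n - k) * t ^ (n - k) / ((n - k).factorial : ℂ) * sqrtCoeff τ k

end

/-- `regHyp` is the Gauss function divided by `Γ(c)`. -/
theorem regHyp_eq (a b c w : ℂ) (hc : ∀ m : ℕ, c ≠ -m) :
    regHyp a b c w = ordinaryHypergeometric a b c w / Complex.Gamma c := by
  rw [ordinaryHypergeometric_eq_tsum, div_eq_mul_inv, ← tsum_mul_right, regHyp]
  refine tsum_congr fun k => ?_
  have h := Complex.Gamma_ne_zero hc
  have h2 : Complex.Gamma (c + k) = poch c k * Complex.Gamma c := by
    rw [poch, ← Complex.Gamma_add_nat_div_Gamma_eq c hc]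
    field_simp
  rw [h2, mul_inv, smul_eq_mul]
  ring

theorem poch_sub_mul (a : ℂ) (n : ℕ) : ∀ k ≤ n,
    poch a (n - k) * poch (1 - a - n) k = (-1) ^ k * poch a n := by
  intro k
  induction k with
  | zero => intro _; simp [poch]
  | succ k ih =>
    intro hk
    rw [pow_succ, mul_right_comm, ← ih (by omega)]
    obtain ⟨m, rfl⟩ : ∃ m, n = m + k + 1 := ⟨n - k - 1, by omega⟩
    have e1 : m + k + 1 - (k + 1) = m := by omega
    have e2 : m + k + 1 - k = m + 1 := by omega
    rw [e1, e2, poch, poch, poch, poch, ascPochhammer_succ_eval, ascPochhammer_succ_eval]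
    push_cast
    ring

theorem inv_factorial_sub (n : ℕ) : ∀ k ≤ n,
    ((n - k).factorial : ℂ)⁻¹ = (-1) ^ k * poch (-n) k / (n.factorial : ℂ) := by
  intro k hk
  have h := poch_sub_mul 1 n k hk
  have e : (1 - 1 - n : ℂ) = -n := by ring
  rw [e] at h
  simp only [poch, ascPochhammer_eval_one] at h
  have h1 : ((n - k).factorial : ℂ) ≠ 0 := by exact_mod_cast Nat.factorial_ne_zero _
  have h2 : (n.factorial : ℂ) ≠ 0 := by exact_mod_cast Nat.factorial_ne_zero _
  have h3 : ((-1 : ℂ) ^ k) * (-1) ^ k = 1 := by rw [← mul_pow]; simp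
  field_simp
  linear_combination (-(-1 : ℂ) ^ k) * h - (n.factorial : ℂ) * h3

theorem poch_two_mul (τ : ℂ) (k : ℕ) :
    4 ^ k * (poch (τ / 2) k * poch ((τ + 1) / 2) k) = poch τ (2 * k) := by
  induction k with
  | zero => simp [poch]
  | succ k ih =>
    rw [Nat.mul_succ]
    simp only [poch, ascPochhammer_succ_eval] at ih ⊢
    rw [← ih]
    push_cast
    ring

/-- `sqrtCoeff` is the quotient of Pochhammer symbols in its description. -/
theorem sqrtCoeff_eq (τ : ℂ) (k : ℕ) (h : poch (τ + 1) k ≠ 0) :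
    sqrtCoeff τ k =
      poch (τ / 2) k * poch ((τ + 1) / 2) k / (poch (τ + 1) k * (k.factorial : ℂ)) := by
  cases k with
  | zero => simp [sqrtCoeff, poch]
  | succ k =>
    have h2 := poch_two_mul τ (k + 1)
    have h3 : poch τ (2 * (k + 1)) = τ * (poch (τ + 1) (k + 1) * poch (τ + k + 2) k) := by
      have e : 2 * (k + 1) = (k + 1 + k) + 1 := by ring
      rw [e, poch, ascPochhammer_succ_left, ← ascPochhammer_mul]
      simp only [Polynomial.eval_mul, Polynomial.eval_comp, Polynomial.eval_add, Polynomial.eval_X,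
        Polynomial.eval_one, Polynomial.eval_natCast, poch]
      have e' : τ + 1 + ((k + 1 : ℕ) : ℂ) = τ + k + 2 := by push_cast; ring
      rw [e']
    have h4 : ((k + 1).factorial : ℂ) ≠ 0 := by exact_mod_cast Nat.factorial_ne_zero _
    rw [h3] at h2
    rw [sqrtCoeff, div_eq_div_iff (mul_ne_zero (by simp) h4) (mul_ne_zero h h4)]
    linear_combination (-((k + 1).factorial : ℂ)) * h2

/-- `gaussPoly` is the terminating Gauss series in its description. -/
theorem gaussPoly_eq (n : ℕ) (τ ρ s : ℂ) (h : ∀ k ≤ n, poch (1 + τ - ρ - n) k ≠ 0) :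
    gaussPoly n τ ρ s = poch (ρ - τ) n / (n.factorial : ℂ) *
      ∑ k ∈ Finset.range (n + 1), poch (-n) k * poch τ k / poch (1 + τ - ρ - n) k *
        ((1 - s) ^ k / (k.factorial : ℂ)) := by
  rw [gaussPoly, Finset.mul_sum]
  refine Finset.sum_congr rfl fun k hk => ?_
  have hk' : k ≤ n := by simpa [Nat.lt_succ_iff] using hk
  have e := poch_sub_mul (ρ - τ) n k hk'
  have e' : (1 - (ρ - τ) - n : ℂ) = 1 + τ - ρ - n := by ring
  rw [e'] at e
  rw [eq_div_of_mul_eq (h k hk') e, div_eq_mul_inv _ ((n - k).factorial : ℂ),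
    inv_factorial_sub n k hk']
  have h3 : ((-1 : ℂ) ^ k) * (-1) ^ k = 1 := by rw [← mul_pow]; simp
  linear_combination (poch (ρ - τ) n / poch (1 + τ - ρ - n) k * poch (-n) k /
    (n.factorial : ℂ) * (poch τ k / (k.factorial : ℂ)) * (1 - s) ^ k) * h3

/-- `clausenPoly` is the terminating Clausen series in its description. -/
theorem clausenPoly_eq (n : ℕ) (ρ τ t : ℂ) (ht : t ≠ 0)
    (h : ∀ k ≤ n, poch (1 - ρ - n) k ≠ 0) (h' : ∀ k ≤ n, poch (τ + 1) k ≠ 0) :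
    clausenPoly n ρ τ t = t ^ n * poch ρ n / (n.factorial : ℂ) *
      ∑ k ∈ Finset.range (n + 1),
        poch (-n) k * poch (τ / 2) k * poch ((τ + 1) / 2) k /
          (poch (τ + 1) k * poch (1 - ρ - n) k) * ((1 / t) ^ k / (k.factorial : ℂ)) := by
  rw [clausenPoly, Finset.mul_sum]
  refine Finset.sum_congr rfl fun k hk => ?_
  have hk' : k ≤ n := by simpa [Nat.lt_succ_iff] using hk
  have e := poch_sub_mul ρ n k hk'
  have ht' : t ^ (n - k) = t ^ n * (1 / t) ^ k := by
    rw [one_div, inv_pow, pow_sub₀ t ht hk']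
  rw [eq_div_of_mul_eq (h k hk') e, ht', div_eq_mul_inv _ ((n - k).factorial : ℂ),
    inv_factorial_sub n k hk', sqrtCoeff_eq τ k (h' k hk')]
  have h3 : ((-1 : ℂ) ^ k) * (-1) ^ k = 1 := by rw [← mul_pow]; simp
  have h4 := h' k hk'
  have h5 := h k hk'
  have h6 : (k.factorial : ℂ) ≠ 0 := by exact_mod_cast Nat.factorial_ne_zero _
  have h7 : (n.factorial : ℂ) ≠ 0 := by exact_mod_cast Nat.factorial_ne_zero _
  field_simp
  linear_combination (poch ρ n * poch (-n) k * poch (τ / 2) k * poch ((τ + 1) / 2) k) * h3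

/-! Put y = (1-x)/(1+x) and β = μ-ν. Up to explicit powers, the Legendre functions at x and 1/x are
regularized Gauss functions at -y and y. The four expansions therefore come from two identities,
each used at z = -y and at z = y: `hasSum_bateman` expands F(2μ-ν, β; 1+μ; -z) in the functions
F(-ν, β+n; 1+μ+n; z), and the `hasSum_clausen_of_...` lemmas expand F(-ν, β; 1+μ; z) in the
functions F(2μ-ν+2n, β+n; 1+μ+n; -z).

When all Gauss functions are expanded, the factor (β)_m / Γ(1+μ+m) depends only on m = n+k, so
collecting powers of z leaves identities between Taylor coefficients. The g_n have generating
function (1+z)^{ν-2μ} (1-z)^{-ν}. The 𝔭_n(ρ,τ,1) have generating function (1-t)^{-ρ}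
((1+√(1-t))/2)^{-τ}, which at t = 4z/(1+z)^2 becomes ((1+z)/(1-z))^{2ρ} (1+z)^τ. Mutual inverseness
comes from the same generating functions.

The Bateman double series converges absolutely for |z| < 1. The Clausen one does so for 4|z| <
(1-|z|)^2, which is x > 2^{-1/2}; equality needs the growth of the coefficients, and for ν-μ in ℕ
the sum is finite. At z = y with general x, Pfaff's transformation turns the terms into powers of
4z/(1+z)^2 with polynomially bounded factors, and the identity is continued analytically from a
neighbourhood of 0. `HasSum` in ℂ is unconditional, hence absolute, summation. -/

section

/-! ### Formal power series and the coefficient identities -/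

open PowerSeries Finset

/-- `(a)_n / n!`, the Taylor coefficients of `(1 - z) ^ (-a)`. -/
noncomputable def binCoeff (a : ℂ) (n : ℕ) : ℂ := poch a n / (n.factorial : ℂ)

/-- The formal power series of `(1 - z) ^ (-a)`. -/
noncomputable def binSeries (a : ℂ) : ℂ⟦X⟧ := mk (binCoeff a)

/-- The formal power series of `(1 + z) ^ (-a)`. -/
noncomputable def altBinSeries (a : ℂ) : ℂ⟦X⟧ := mk fun n => (-1) ^ n * binCoeff a n

theorem poch_zero_right (a : ℂ) : poch a 0 = 1 := by simp [poch]

theorem poch_succ (a : ℂ) (n : ℕ) : poch a (n + 1) = poch a n * (a + n) := by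
  simp [poch, ascPochhammer_succ_eval]

theorem poch_add (a : ℂ) (n k : ℕ) : poch a (n + k) = poch a n * poch (a + n) k := by
  induction k with
  | zero => simp [poch_zero_right]
  | succ k ih =>
    rw [← add_assoc, poch_succ, ih, poch_succ]
    push_cast
    ring

theorem poch_succ' (a : ℂ) (n : ℕ) : poch a (n + 1) = a * poch (a + 1) n := by
  rw [add_comm n 1, poch_add, poch_succ]
  simp [poch_zero_right]

theorem binCoeff_zero_right (a : ℂ) : binCoeff a 0 = 1 := by simp [binCoeff, poch]

theorem binCoeff_succ (a : ℂ) (n : ℕ) : binCoeff a (n + 1) * (n + 1) = (a + n) * binCoeff a n := by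
  have h : (n.factorial : ℂ) ≠ 0 := by exact_mod_cast n.factorial_ne_zero
  have h' : (n + 1 : ℂ) ≠ 0 := by exact_mod_cast n.succ_ne_zero
  rw [binCoeff, binCoeff, poch_succ, Nat.factorial_succ]
  push_cast
  field_simp

theorem one_sub_X_mul_derivative_binSeries (a : ℂ) :
    (1 - X) * d⁄dX ℂ (binSeries a) = C a * binSeries a := by
  ext n
  rw [sub_mul, one_mul, map_sub, coeff_C_mul]
  cases n with
  | zero =>
    simp [coeff_derivative, binSeries]
    simpa [binCoeff_zero_right] using binCoeff_succ a 0
  | succ n =>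
    rw [coeff_succ_X_mul, coeff_derivative, coeff_derivative]
    simp only [binSeries, coeff_mk]
    have := binCoeff_succ a (n + 1)
    push_cast at this ⊢
    linear_combination this

/-- The equation (1-z)F' = aF is a first-order recurrence for the coefficients, so the constant term
determines F. The multiplication law and the substitution formula are verified through it. -/
theorem eq_binSeries_of_derivative {a : ℂ} {F : ℂ⟦X⟧} (h0 : constantCoeff F = 1)
    (h : (1 - X) * d⁄dX ℂ F = C a * F) : F = binSeries a := by
  ext n
  rw [binSeries, coeff_mk]
  induction n with
  | zero => simpa [binCoeff_zero_right] using h0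
  | succ n ih =>
    have h' : (n + 1 : ℂ) ≠ 0 := by exact_mod_cast n.succ_ne_zero
    have hn := congrArg (coeff n) h
    have hb := binCoeff_succ a n
    rw [← ih] at hb
    refine mul_right_cancel₀ h' (hb ▸ ?_)
    rw [sub_mul, one_mul, map_sub, coeff_C_mul] at hn
    cases n with
    | zero => simp [coeff_derivative] at hn ⊢; exact hn
    | succ n =>
      rw [coeff_succ_X_mul, coeff_derivative, coeff_derivative] at hn
      push_cast at hn ⊢
      linear_combination hn

theorem constantCoeff_binSeries (a : ℂ) : constantCoeff (binSeries a) = 1 := by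
  rw [← coeff_zero_eq_constantCoeff_apply, binSeries, coeff_mk, binCoeff_zero_right]

theorem binSeries_add (a c : ℂ) : binSeries (a + c) = binSeries a * binSeries c := by
  refine (eq_binSeries_of_derivative ?_ ?_).symm
  · simp [constantCoeff_binSeries]
  · rw [Derivation.leibniz, smul_eq_mul, smul_eq_mul, map_add]
    linear_combination binSeries a * one_sub_X_mul_derivative_binSeries c +
      binSeries c * one_sub_X_mul_derivative_binSeries a

theorem binSeries_zero : binSeries 0 = 1 :=
  (eq_binSeries_of_derivative (by simp) (by simp)).symm

theorem altBinSeries_eq (a : ℂ) : altBinSeries a = rescale (-1 : ℂ) (binSeries a) := by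
  ext n; simp [altBinSeries, binSeries, coeff_rescale]

theorem altBinSeries_add (a c : ℂ) :
    altBinSeries (a + c) = altBinSeries a * altBinSeries c := by
  simp only [altBinSeries_eq, binSeries_add, map_mul]

theorem altBinSeries_zero : altBinSeries 0 = 1 := by
  simp only [altBinSeries_eq, binSeries_zero, map_one]

theorem altBinSeries_add_two_mul (a : ℂ) (n : ℕ) :
    altBinSeries (a + 2 * n) = altBinSeries a * altBinSeries 2 ^ n := by
  induction n with
  | zero => simp
  | succ n ih =>
    rw [pow_succ, ← mul_assoc, ← ih, ← altBinSeries_add]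
    push_cast
    ring_nf

theorem one_add_X_mul_derivative_altBinSeries (a : ℂ) :
    (1 + X) * d⁄dX ℂ (altBinSeries a) = -C a * altBinSeries a := by
  ext n
  rw [add_mul, one_mul, map_add, neg_mul, map_neg, coeff_C_mul]
  cases n with
  | zero =>
    simp [coeff_derivative, altBinSeries]
    simpa [binCoeff_zero_right] using binCoeff_succ a 0
  | succ n =>
    rw [coeff_succ_X_mul, coeff_derivative, coeff_derivative]
    simp only [altBinSeries, coeff_mk]
    have := binCoeff_succ a (n + 1)
    push_cast at this ⊢
    linear_combination (-1) ^ (n + 2) * this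

theorem one_add_X_mul_altBinSeries_one : (1 + X) * altBinSeries 1 = 1 := by
  have : altBinSeries (-1) = 1 + X := by
    ext n
    simp only [altBinSeries, coeff_mk, map_add, coeff_one, coeff_X]
    rcases n with _ | _ | n
    · simp [binCoeff_zero_right]
    · simp [binCoeff, poch]
    · have : poch (-1) (n + 2) = 0 := by rw [add_comm, poch_add, poch_succ, poch_succ]; simp
      simp [binCoeff, this]
  rw [← this, ← altBinSeries_add, neg_add_cancel, altBinSeries_zero]

theorem altBinSeries_two : altBinSeries 2 = altBinSeries 1 ^ 2 := by
  rw [sq, ← altBinSeries_add]; norm_num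

/-- The formal series `z / (1 + z) ^ 2`. -/
noncomputable def koebe : ℂ⟦X⟧ := X * altBinSeries 2

theorem hasSubst_koebe : HasSubst koebe := HasSubst.of_constantCoeff_zero' (by simp [koebe])

/-- The d-th power of `koebe` is z^d (1+z)^{-2d}, which shifts the exponent a to a+2d; this is the
source of the shift 2n in the Clausen series. Only d ≤ m contributes because `koebe` has order one.
-/
theorem coeff_altBinSeries_mul_subst (q : ℕ → ℂ) (a : ℂ) (m : ℕ) :
    coeff m (altBinSeries a * (mk q).subst koebe) =
      ∑ p ∈ antidiagonal m, q p.1 * ((-1) ^ p.2 * binCoeff (a + 2 * p.1) p.2) := by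
  have hz : ∀ j d : ℕ, j < d → coeff j (koebe ^ d) = 0 := fun j d h => by
    rw [koebe, mul_pow, coeff_X_pow_mul', if_neg (by omega)]
  have h1 : ∀ j ∈ range (m + 1), coeff j ((mk q).subst koebe) =
      ∑ d ∈ range (m + 1), q d * coeff j (koebe ^ d) := fun j hj => by
    rw [coeff_subst' hasSubst_koebe, finsum_eq_sum_of_support_subset (s := range (m + 1))]
    · simp
    · intro d hd
      by_contra hd'
      simp only [coe_range, Set.mem_Iio, not_lt, mem_range] at hd' hj
      exact hd (by simp only [hz j d (by omega), smul_zero])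
  have h2 : coeff m (altBinSeries a * (mk q).subst koebe) =
      ∑ d ∈ range (m + 1), q d * coeff m (altBinSeries a * koebe ^ d) := by
    simp only [coeff_mul, mul_sum]
    rw [sum_comm]
    refine sum_congr rfl fun p hp => ?_
    have := mem_antidiagonal.1 hp
    rw [h1 p.2 (mem_range.2 (by omega)), mul_sum]
    exact sum_congr rfl fun d _ => by ring
  rw [h2, Nat.sum_antidiagonal_eq_sum_range_succ
    (fun i j => q i * ((-1) ^ j * binCoeff (a + 2 * i) j))]
  refine sum_congr rfl fun d hd => ?_
  have : d ≤ m := by simpa [Nat.lt_succ_iff] using hd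
  rw [koebe, mul_pow, mul_left_comm, ← altBinSeries_add_two_mul, coeff_X_pow_mul', if_pos this,
    altBinSeries, coeff_mk]

theorem derivative_koebe : (1 + X) ^ 3 * d⁄dX ℂ koebe = 1 - X := by
  rw [koebe, Derivation.leibniz, smul_eq_mul, smul_eq_mul, derivative_X, altBinSeries_two]
  have h1 := one_add_X_mul_altBinSeries_one
  have h2 := one_add_X_mul_derivative_altBinSeries 1
  rw [sq, Derivation.leibniz, smul_eq_mul]
  have h3 : (1 + X) * d⁄dX ℂ (altBinSeries 1) = - altBinSeries 1 := by
    rw [h2]; simp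
  set e := altBinSeries 1
  set e' := d⁄dX ℂ e
  linear_combination ((1+X)*e+1) * (1 + X) * h1 + 2 * X * (1+X)^2 * e * h3
     - 2 * X * ((1+X)*e+1) * h1

/-- With K = z/(1+z)^2 one has 1-4K = ((1-z)/(1+z))^2, so (1-4K)^{-r} = ((1+z)/(1-z))^{2r}. -/
theorem binSeries_subst_koebe (r : ℂ) :
    altBinSeries (2 * r) * (mk fun n => 4 ^ n * binCoeff r n).subst koebe = binSeries (2 * r) := by
  set Q : ℂ⟦X⟧ := mk fun n => 4 ^ n * binCoeff r n with hQ
  have hQ' : (1 - C (4 : ℂ) * X) * d⁄dX ℂ Q = C (4 * r) * Q := by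
    ext n
    rw [sub_mul, one_mul, map_sub, coeff_C_mul, mul_assoc, coeff_C_mul]
    cases n with
    | zero =>
      have := binCoeff_succ r 0
      simp only [hQ, coeff_derivative, coeff_mk, coeff_zero_X_mul]
      push_cast at this ⊢
      linear_combination 4 * this
    | succ n =>
      rw [coeff_succ_X_mul, coeff_derivative, coeff_derivative]
      simp only [hQ, coeff_mk]
      have := binCoeff_succ r (n + 1)
      push_cast at this ⊢
      linear_combination 4 ^ (n + 2) * this
  have h1 : (1 - 4 * koebe) * (d⁄dX ℂ Q).subst koebe = C (4 * r) * Q.subst koebe := by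
    have := congrArg (substAlgHom hasSubst_koebe) hQ'
    rw [map_mul, map_mul, map_sub, map_one, map_mul] at this
    simp only [coe_substAlgHom, subst_X hasSubst_koebe, subst_C] at this
    have h4 : (4 : ℂ⟦X⟧) = C 4 := (map_ofNat (C : ℂ →+* ℂ⟦X⟧) 4).symm
    rw [h4]
    exact this
  have h2 : d⁄dX ℂ (Q.subst koebe) = (d⁄dX ℂ Q).subst koebe * d⁄dX ℂ koebe :=
    derivative_subst hasSubst_koebe
  have h3 := derivative_koebe
  have h4 : (1 + X) ^ 2 * koebe = X := by
    rw [koebe, altBinSeries_two]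
    linear_combination X * ((1 + X) * altBinSeries 1 + 1) * one_add_X_mul_altBinSeries_one
  have h5 := one_add_X_mul_derivative_altBinSeries (2 * r)
  have hX : (1 + X : ℂ⟦X⟧) ≠ 0 := left_ne_zero_of_mul_eq_one one_add_X_mul_altBinSeries_one
  set Y := Q.subst koebe
  set P := (d⁄dX ℂ Q).subst koebe
  have e4 : C (4 * r) = (4 : ℂ⟦X⟧) * C r := by rw [map_mul]; rfl
  have e2 : C (2 * r) = (2 : ℂ⟦X⟧) * C r := by rw [map_mul]; rfl
  rw [e4] at h1
  rw [e2] at h5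
  -- The logarithmic derivative of ((1+z)/(1-z))^{2r} is 4r/(1-z^2).
  have h6 : (1 - X) * (1 + X) * d⁄dX ℂ Y = 4 * C r * Y := by
    refine mul_left_cancel₀ (pow_ne_zero 2 hX) ?_
    linear_combination (1 - X) * (1 + X) ^ 3 * h2 + (1 - X) * P * h3 + (1 + X) ^ 2 * h1 + 4 * P * h4
  refine eq_binSeries_of_derivative ?_ ?_
  · rw [← coeff_zero_eq_constantCoeff_apply, coeff_altBinSeries_mul_subst]
    simp [binCoeff_zero_right]
  · rw [Derivation.leibniz, smul_eq_mul, smul_eq_mul, e2]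
    refine mul_left_cancel₀ hX ?_
    linear_combination altBinSeries (2 * r) * h6 + (1 - X) * Y * h5

theorem fwdDiff_iter_poch_eq_zero (r : ℕ) : ∀ z : ℂ,
    (fwdDiff (1 : ℂ))^[r + 1] (fun z => poch z r) z = 0 := by
  induction r with
  | zero => intro z; simp [poch_zero_right, fwdDiff]
  | succ r ih =>
    intro z
    rw [Function.iterate_succ_apply]
    have : fwdDiff (1 : ℂ) (fun z => poch z (r + 1)) = ((r + 1 : ℂ) • fun z => poch (z + 1) r) := by
      ext z
      simp only [fwdDiff, Pi.smul_apply, smul_eq_mul]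
      rw [poch_succ, poch_succ']
      ring
    rw [this, fwdDiff_iter_const_smul, Pi.smul_apply,
      fwdDiff_iter_comp_add _ (fun z => poch z r), ih, smul_zero]

/-- Behind this lies the generating function ((1+√(1-w))/2)^{-t}: at w = 4z/(1+z)^2 the root is
(1-z)/(1+z), and the value is (1+z)^t. The proof needs no root: the coefficient of z^{m+1} is
t/(m+1)! times an (m+1)-st difference of a polynomial of degree m. -/
theorem sqrtCoeff_subst_koebe (t : ℂ) :
    altBinSeries t * (mk fun n => 4 ^ n * sqrtCoeff t n).subst koebe = 1 := by
  ext m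
  rw [coeff_altBinSeries_mul_subst]
  cases m with
  | zero => simp [binCoeff_zero_right, sqrtCoeff]
  | succ m =>
    have h := fwdDiff_iter_poch_eq_zero m (t + 1)
    rw [fwdDiff_iter_eq_sum_shift] at h
    rw [coeff_one, if_neg (by omega), Nat.sum_antidiagonal_eq_sum_range_succ
      (fun i j => 4 ^ i * sqrtCoeff t i * ((-1) ^ j * binCoeff (t + 2 * i) j)),
      ← mul_zero (t / ((m + 1).factorial : ℂ)), ← h, mul_sum]
    refine sum_congr rfl fun k hk => ?_
    obtain ⟨l, hl⟩ := Nat.exists_eq_add_of_le (Nat.lt_succ_iff.1 (mem_range.1 hk))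
    have h2 : (l.factorial : ℂ) ≠ 0 := by exact_mod_cast l.factorial_ne_zero
    have h3 : (k.factorial : ℂ) ≠ 0 := by exact_mod_cast k.factorial_ne_zero
    have h4 : (((m + 1).factorial : ℕ) : ℂ) ≠ 0 := by exact_mod_cast (m + 1).factorial_ne_zero
    have h5 : ((m + 1).choose k : ℂ) = ((m + 1).factorial : ℂ) / (k.factorial * l.factorial) := by
      rw [hl, Nat.cast_add_choose]
    have e : m + 1 - k = l := by omega
    simp only [e, zsmul_eq_mul, nsmul_eq_mul]
    push_cast
    rw [h5, binCoeff]
    cases k with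
    | zero =>
      obtain rfl : l = m + 1 := by omega
      simp [sqrtCoeff, poch_succ']
      field_simp
    | succ k =>
      -- The numerators of the two coefficients are adjacent stretches of one Pochhammer symbol, of
      -- total length k+l = m.
      have : poch (t + 1 + ((k + 1 : ℕ) : ℂ) * 1) m = poch (t + k + 2) k * poch (t + 2 * (k + 1)) l := by
        obtain rfl : m = k + l := by omega
        rw [poch_add]
        push_cast
        ring_nf
      rw [this, sqrtCoeff]
      push_cast
      field_simp

theorem mk_clausenPoly (ρ τ : ℂ) :
    (mk fun n => 4 ^ n * clausenPoly n ρ τ 1 : ℂ⟦X⟧) =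
      (mk fun n => 4 ^ n * binCoeff ρ n) * mk fun n => 4 ^ n * sqrtCoeff τ n := by
  ext n
  rw [mul_comm, coeff_mul, coeff_mk, clausenPoly, Nat.sum_antidiagonal_eq_sum_range_succ_mk, mul_sum]
  refine sum_congr rfl fun k hk => ?_
  have : n = k + (n - k) := by have := mem_range.1 hk; omega
  simp only [coeff_mk, binCoeff, one_pow]
  rw [show (4 : ℂ) ^ n = 4 ^ k * 4 ^ (n - k) by rw [← pow_add, ← this]]
  ring

theorem altBinSeries_mul_clausen (ρ τ : ℂ) :
    altBinSeries (2 * ρ + τ) * (mk fun n => 4 ^ n * clausenPoly n ρ τ 1).subst koebe =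
      binSeries (2 * ρ) := by
  rw [mk_clausenPoly, subst_mul hasSubst_koebe, altBinSeries_add, mul_mul_mul_comm,
    binSeries_subst_koebe, sqrtCoeff_subst_koebe, mul_one]

theorem sum_antidiagonal_clausenPoly (ν μ : ℂ) (m : ℕ) :
    ∑ p ∈ antidiagonal m, 4 ^ p.1 * clausenPoly p.1 (-ν / 2) (2 * μ) 1 *
      ((-1) ^ p.2 * binCoeff (2 * μ - ν + 2 * p.1) p.2) = binCoeff (-ν) m := by
  have h := congrArg (coeff m) (altBinSeries_mul_clausen (-ν / 2) (2 * μ))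
  rw [coeff_altBinSeries_mul_subst] at h
  rw [show 2 * (-ν / 2) = -ν by ring, show -ν + 2 * μ = 2 * μ - ν by ring] at h
  rw [h, binSeries, coeff_mk]

theorem mk_batemanPoly (τ r : ℂ) :
    (mk fun n => batemanPoly n τ r : ℂ⟦X⟧) = altBinSeries (-r - τ) * binSeries τ := by
  ext n
  rw [mul_comm, coeff_mul, coeff_mk, batemanPoly, gaussPoly, Nat.sum_antidiagonal_eq_sum_range_succ_mk,
    mul_sum]
  refine sum_congr rfl fun k hk => ?_
  have : n = k + (n - k) := by have := mem_range.1 hk; omega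
  simp only [binSeries, altBinSeries, coeff_mk, binCoeff]
  rw [show (-1 : ℂ) ^ n = (-1) ^ k * (-1) ^ (n - k) by rw [← pow_add, ← this]]
  have h : (1 - 2 : ℂ) ^ k * (-1) ^ k = 1 := by rw [← mul_pow]; norm_num
  linear_combination ((-1) ^ (n - k) * poch (-r - τ) (n - k) / ((n - k).factorial) *
    (poch τ k / k.factorial)) * h

theorem sum_antidiagonal_batemanPoly (ν μ : ℂ) (m : ℕ) :
    ∑ p ∈ antidiagonal m, batemanPoly p.1 ν (-2 * μ) * binCoeff (-ν) p.2 =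
      (-1) ^ m * binCoeff (2 * μ - ν) m := by
  have h : (mk fun n => batemanPoly n ν (-2 * μ) : ℂ⟦X⟧) * binSeries (-ν) =
      altBinSeries (2 * μ - ν) := by
    rw [mk_batemanPoly, mul_assoc, ← binSeries_add, add_neg_cancel, binSeries_zero, mul_one]
    ring_nf
  have := congrArg (coeff m) h
  rw [coeff_mul] at this
  simpa [altBinSeries, binSeries] using this

/-- Replacing μ by μ+k multiplies the Bateman generating function by (1+z)^{-2k}, the factor that
`koebe` powers carry. The sum is thus a coefficient of (1-z)^ν (1-z)^{-ν} = 1. -/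
theorem sum_clausenPoly_mul_batemanPoly (ν μ : ℂ) (n : ℕ) :
    ∑ k ∈ range (n + 1),
      4 ^ k * clausenPoly k (-ν / 2) (2 * μ) 1 * batemanPoly (n - k) ν (-2 * (μ + k)) =
        if n = 0 then 1 else 0 := by
  have hg : ∀ k j : ℕ, batemanPoly j ν (-2 * (μ + k)) =
      ∑ p ∈ antidiagonal j, (-1) ^ p.1 * binCoeff (2 * μ - ν + 2 * k) p.1 * binCoeff ν p.2 := by
    intro k j
    have := congrArg (coeff j) (mk_batemanPoly ν (-2 * (μ + k)))
    rw [coeff_mul, coeff_mk] at this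
    rw [this]
    simp only [altBinSeries, binSeries, coeff_mk]
    rw [show -(-2 * (μ + k)) - ν = 2 * μ - ν + 2 * k by ring]
  have h : altBinSeries (2 * μ - ν) *
      (mk fun n => 4 ^ n * clausenPoly n (-ν / 2) (2 * μ) 1).subst koebe * binSeries ν = 1 := by
    have := altBinSeries_mul_clausen (-ν / 2) (2 * μ)
    rw [show 2 * (-ν / 2) = -ν by ring, show -ν + 2 * μ = 2 * μ - ν by ring] at this
    rw [this, ← binSeries_add, neg_add_cancel, binSeries_zero]
  have h' := congrArg (coeff n) h
  rw [coeff_mul, coeff_one] at h'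
  rw [← h', ← Nat.sum_antidiagonal_eq_sum_range_succ (fun k j =>
    4 ^ k * clausenPoly k (-ν / 2) (2 * μ) 1 * batemanPoly j ν (-2 * (μ + k)))]
  simp only [hg, coeff_altBinSeries_mul_subst, binSeries, coeff_mk, mul_sum, sum_mul]
  rw [sum_sigma', sum_sigma']
  -- Both sides are sums over triples of indices with total n; the bijection reassociates them.
  refine sum_nbij' (fun q => ⟨(q.1.1 + q.2.1, q.2.2), (q.1.1, q.2.1)⟩)
    (fun q => ⟨(q.2.1, q.2.2 + q.1.2), (q.2.2, q.1.2)⟩) ?_ ?_ ?_ ?_ ?_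
  · rintro ⟨⟨a, b⟩, ⟨c, d⟩⟩ h
    simp only [mem_sigma, HasAntidiagonal.mem_antidiagonal] at h ⊢
    obtain ⟨rfl, rfl⟩ := h
    simp [add_assoc]
  · rintro ⟨⟨a, b⟩, ⟨c, d⟩⟩ h
    simp only [mem_sigma, HasAntidiagonal.mem_antidiagonal] at h ⊢
    obtain ⟨rfl, rfl⟩ := h
    simp [add_assoc]
  · rintro ⟨⟨a, b⟩, ⟨c, d⟩⟩ h
    simp only [mem_sigma, HasAntidiagonal.mem_antidiagonal] at h ⊢
    obtain ⟨rfl, rfl⟩ := h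
    rfl
  · rintro ⟨⟨a, b⟩, ⟨c, d⟩⟩ h
    simp only [mem_sigma, HasAntidiagonal.mem_antidiagonal] at h ⊢
    obtain ⟨rfl, rfl⟩ := h
    rfl
  · rintro ⟨⟨a, b⟩, ⟨c, d⟩⟩ h
    ring

/-- The hypothesis makes one lower triangular matrix a left inverse of another. For finite square
matrices it is then a right inverse, and the claim is the corner entry (n, 0) of the reversed
product. -/
theorem sum_triangular_inverse {a b : ℕ → ℕ → ℂ}
    (h : ∀ j n, ∑ k ∈ range (n + 1), a j k * b (j + k) (n - k) = if n = 0 then 1 else 0) (n : ℕ) :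
    ∑ k ∈ range (n + 1), b 0 k * a k (n - k) = if n = 0 then 1 else 0 := by
  let A : Matrix (Fin (n + 1)) (Fin (n + 1)) ℂ :=
    Matrix.of fun i j => if (j : ℕ) ≤ i then a j (i - j) else 0
  let B : Matrix (Fin (n + 1)) (Fin (n + 1)) ℂ :=
    Matrix.of fun i j => if (j : ℕ) ≤ i then b j (i - j) else 0
  have hBA : B * A = 1 := by
    ext i j
    rw [Matrix.mul_apply]
    simp only [A, B, Matrix.of_apply]
    rw [Fin.sum_univ_eq_sum_range (fun k => (if k ≤ (i : ℕ) then b k (i - k) else 0) *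
      (if (j : ℕ) ≤ k then a j (k - j) else 0)) (n + 1)]
    simp only [ite_mul, zero_mul, mul_ite, mul_zero, ← ite_and]
    rw [← sum_filter]
    have hf : (range (n + 1)).filter (fun k => (j : ℕ) ≤ k ∧ k ≤ (i : ℕ)) = Ico (j : ℕ) (i + 1) := by
      ext k
      have := i.2
      simp only [mem_filter, mem_range, mem_Ico]
      omega
    rw [hf, sum_Ico_eq_sum_range, Matrix.one_apply]
    by_cases hij : (j : ℕ) ≤ i
    · have h1 := h j (i - j)
      rw [show (i : ℕ) + 1 - j = i - j + 1 by omega]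
      have h2 : ((i : ℕ) - j = 0) = (i = j) := by
        rw [Fin.ext_iff]; apply propext; omega
      rw [if_congr (iff_of_eq h2) rfl rfl] at h1
      rw [← h1]
      refine sum_congr rfl fun k _ => ?_
      rw [add_tsub_cancel_left, Nat.sub_sub, mul_comm]
    · rw [show (i : ℕ) + 1 - j = 0 by omega, if_neg (fun h => hij (by rw [h]))]
      simp
  have h0 : (A * B) (Fin.last n) 0 =
      (1 : Matrix (Fin (n + 1)) (Fin (n + 1)) ℂ) (Fin.last n) 0 := by
    rw [mul_eq_one_comm.1 hBA]
  rw [Matrix.mul_apply] at h0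
  simp only [A, B, Matrix.of_apply, Matrix.one_apply] at h0
  rw [Fin.sum_univ_eq_sum_range (fun k => (if k ≤ ((Fin.last n : Fin (n + 1)) : ℕ) then
    a k ((Fin.last n : Fin (n + 1)) - k) else 0) *
    (if ((0 : Fin (n + 1)) : ℕ) ≤ k then b (0 : Fin (n + 1)) (k - (0 : Fin (n + 1))) else 0)) (n + 1)]
    at h0
  simp only [Fin.val_last, Fin.val_zero, zero_le, if_true, Nat.sub_zero, Fin.ext_iff] at h0
  rw [← h0]
  refine sum_congr rfl fun k hk => ?_
  rw [if_pos (Nat.lt_succ_iff.1 (mem_range.1 hk)), mul_comm]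

theorem sum_batemanPoly_mul_clausenPoly (ν μ : ℂ) (n : ℕ) :
    ∑ k ∈ range (n + 1), batemanPoly k ν (-2 * μ) *
      (4 ^ (n - k) * clausenPoly (n - k) (-ν / 2) (2 * (μ + k)) 1) = if n = 0 then 1 else 0 := by
  have := sum_triangular_inverse (a := fun j k => 4 ^ k * clausenPoly k (-ν / 2) (2 * (μ + j)) 1)
    (b := fun j k => batemanPoly k ν (-2 * (μ + j))) (fun j n => ?_) n
  · simpa using this
  · rw [← sum_clausenPoly_mul_batemanPoly ν (μ + j) n]
    simp [add_assoc]

end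

/-! ### Growth of the coefficients -/

section

open Filter Asymptotics Topology

theorem isBigO_add_one_rpow_of_shift {f : ℕ → ℂ} {p : ℝ}
    (h : (fun k => f (k + 1)) =O[atTop] fun k : ℕ => (k : ℝ) ^ p) :
    f =O[atTop] fun k : ℕ => ((k : ℝ) + 1) ^ p := by
  have h1 : (fun k => f (k + 1)) =O[atTop] fun k : ℕ => ((((k + 1 : ℕ) : ℝ)) + 1) ^ p := by
    -- The constant comes from k ≤ k+2 ≤ 3k for k ≥ 1.
    refine h.trans (IsBigO.of_bound (3 ^ |p|) ?_)
    filter_upwards [eventually_ge_atTop 1] with k hk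
    have hk' : (1 : ℝ) ≤ k := by exact_mod_cast hk
    rw [Real.norm_of_nonneg (by positivity), Real.norm_of_nonneg (by positivity)]
    push_cast
    rcases le_total 0 p with hp | hp
    · calc (k : ℝ) ^ p ≤ (k + 1 + 1 : ℝ) ^ p := by gcongr; linarith
        _ ≤ _ := le_mul_of_one_le_left (by positivity)
          (Real.one_le_rpow (by norm_num) (abs_nonneg p))
    · rw [abs_of_nonpos hp]
      calc (k : ℝ) ^ p = 3 ^ (-p) * (3 * k : ℝ) ^ p := by
            rw [Real.mul_rpow (by norm_num) (by positivity), ← mul_assoc,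
              ← Real.rpow_add (by norm_num)]
            simp
        _ ≤ _ := by
            gcongr 3 ^ (-p) * ?_
            exact Real.rpow_le_rpow_of_nonpos (by positivity) (by linarith) hp
  rw [IsBigO_def] at h1 ⊢
  obtain ⟨c, hc⟩ := h1
  refine ⟨c, ?_⟩
  rw [IsBigOWith_def] at hc ⊢
  rw [← map_add_atTop_eq_nat 1, eventually_map]
  exact hc

theorem prod_range_add_eq_poch (a : ℂ) (n : ℕ) : ∏ j ∈ Finset.range n, (a + j) = poch a n := by
  induction n with
  | zero => simp [poch_zero_right]
  | succ n ih => rw [Finset.prod_range_succ, ih, poch_succ]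

theorem gammaSeq_eq (a : ℂ) (n : ℕ) :
    Complex.GammaSeq a n = (n : ℂ) ^ a * n.factorial / poch a (n + 1) := by
  rw [Complex.GammaSeq, prod_range_add_eq_poch]

theorem poch_ne_zero {a : ℂ} (ha : ∀ m : ℕ, a ≠ -m) (n : ℕ) : poch a n ≠ 0 := by
  rw [← prod_range_add_eq_poch]
  exact Finset.prod_ne_zero_iff.2 fun j _ h => ha j (eq_neg_of_add_eq_zero_left h)

/-- Euler's limit formula for Γ gives the order; for a nonpositive integer a the coefficients vanish
eventually. -/
theorem binCoeff_isBigO (a : ℂ) :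
    binCoeff a =O[atTop] fun k : ℕ => ((k : ℝ) + 1) ^ (a.re - 1) := by
  by_cases ha : ∀ m : ℕ, a ≠ -m
  · refine isBigO_add_one_rpow_of_shift ?_
    have h := ((Complex.GammaSeq_tendsto_Gamma a).inv₀ (Complex.Gamma_ne_zero ha)).isBigO_one ℝ
    have h2 : (fun k : ℕ => (k : ℂ) ^ a / (k + 1)) =O[atTop] fun k : ℕ => (k : ℝ) ^ (a.re - 1) := by
      refine IsBigO.of_bound 1 ?_
      filter_upwards [eventually_ge_atTop 1] with k hk
      have hk' : (0 : ℝ) < k := by exact_mod_cast hk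
      have e : ‖(k + 1 : ℂ)‖ = k + 1 := by exact_mod_cast Complex.norm_natCast (k + 1)
      rw [norm_div, Complex.norm_natCast_cpow_of_pos hk, e, Real.norm_of_nonneg (by positivity), one_mul,
        Real.rpow_sub_one hk'.ne']
      gcongr
      linarith
    refine ((h2.mul h).congr' ?_ ?_)
    · filter_upwards [eventually_ge_atTop 1] with k hk
      have h3 : (k.factorial : ℂ) ≠ 0 := by exact_mod_cast k.factorial_ne_zero
      have h4 : (k : ℂ) ^ a ≠ 0 := by
        rw [Ne, Complex.cpow_eq_zero_iff]; simp; omega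
      have h5 : (k + 1 : ℂ) ≠ 0 := by exact_mod_cast k.succ_ne_zero
      rw [gammaSeq_eq, binCoeff, Nat.factorial_succ]
      push_cast
      field_simp
    · exact Eventually.of_forall fun k => by simp
  · push Not at ha
    obtain ⟨m, rfl⟩ := ha
    refine IsBigO.of_bound 0 ?_
    filter_upwards [eventually_gt_atTop m] with k hk
    obtain ⟨l, rfl⟩ := Nat.exists_eq_add_of_lt hk
    rw [binCoeff, add_assoc, add_comm l, ← add_assoc, poch_add, poch_succ]
    simp

/-- Euler's limit settles Re c > 0. The relation 1/Γ(c) = c/Γ(c+1) then moves the half-plane left by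
one unit at a time, poles of Γ included. -/
theorem factorial_mul_inv_Gamma_isBigO (c : ℂ) :
    (fun k : ℕ => (k.factorial : ℂ) * (Complex.Gamma (c + k))⁻¹) =O[atTop]
      fun k : ℕ => ((k : ℝ) + 1) ^ (1 - c.re) := by
  suffices ∀ N : ℕ, ∀ c : ℂ, -(N : ℝ) < c.re →
      (fun k : ℕ => (k.factorial : ℂ) * (Complex.Gamma (c + k))⁻¹) =O[atTop]
        fun k : ℕ => ((k : ℝ) + 1) ^ (1 - c.re) by
    obtain ⟨N, hN⟩ := exists_nat_gt (-c.re)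
    exact this N c (by linarith)
  intro N
  induction N with
  | zero =>
    intro c hc
    have hc' : ∀ m : ℕ, c ≠ -m := by
      rintro m rfl
      simp at hc
      have : (0 : ℝ) ≤ m := m.cast_nonneg
      linarith
    refine isBigO_add_one_rpow_of_shift ?_
    have h := (Complex.GammaSeq_tendsto_Gamma c).isBigO_one ℝ
    have h2 : (fun k : ℕ => ((k + 1 : ℂ) / (k : ℂ) ^ c * (Complex.Gamma c)⁻¹)) =O[atTop]
        fun k : ℕ => (k : ℝ) ^ (1 - c.re) := by
      refine IsBigO.of_bound (2 * ‖(Complex.Gamma c)⁻¹‖) ?_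
      filter_upwards [eventually_ge_atTop 1] with k hk
      have hk' : (1 : ℝ) ≤ k := by exact_mod_cast hk
      have e : ‖(k + 1 : ℂ)‖ = k + 1 := by exact_mod_cast Complex.norm_natCast (k + 1)
      rw [norm_mul, norm_div, Complex.norm_natCast_cpow_of_pos hk, e, Real.norm_of_nonneg (by positivity),
        Real.rpow_sub (by linarith), Real.rpow_one, mul_right_comm]
      gcongr
      rw [← mul_div_assoc]
      gcongr
      linarith
    refine ((h2.mul h).congr' ?_ ?_)
    · filter_upwards [eventually_ge_atTop 1] with k hk
      have h4 : (k : ℂ) ^ c ≠ 0 := by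
        rw [Ne, Complex.cpow_eq_zero_iff]; simp; omega
      have h6 := poch_ne_zero hc' (k + 1)
      have h7 := Complex.Gamma_add_nat_div_Gamma_eq c (n := k + 1) hc'
      have h8 := Complex.Gamma_ne_zero hc'
      rw [div_eq_iff h8] at h7
      rw [h7, gammaSeq_eq, Nat.factorial_succ]
      push_cast
      field_simp
    · exact Eventually.of_forall fun k => by simp
  | succ N ih =>
    intro c hc
    have h := ih (c + 1) (by push_cast at hc; simp; linarith)
    have h2 : (fun k : ℕ => c + k) =O[atTop] fun k : ℕ => ((k : ℝ) + 1) := by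
      refine IsBigO.of_bound (‖c‖ + 1) (Eventually.of_forall fun k => ?_)
      rw [Real.norm_of_nonneg (by positivity)]
      calc ‖c + k‖ ≤ ‖c‖ + k := (norm_add_le _ _).trans (by simp)
        _ ≤ _ := by nlinarith [norm_nonneg c, (k.cast_nonneg : (0 : ℝ) ≤ k)]
    refine ((h2.mul h).congr' ?_ ?_)
    · refine Eventually.of_forall fun k => ?_
      simp only
      rw [Complex.one_div_Gamma_eq_self_mul_one_div_Gamma_add_one (c + k)]
      ring_nf
    · refine Eventually.of_forall fun k => ?_
      simp only
      rw [mul_comm, ← Real.rpow_add_one (by positivity)]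
      simp only [Complex.add_re, Complex.one_re]
      ring_nf

/-- S = (1+√(1-w))/2 satisfies S^2 = S - w/4; multiply by S^{-t-2} and compare coefficients of
w^{k+1}. -/
theorem sqrtCoeff_recurrence (t : ℂ) (k : ℕ) :
    sqrtCoeff t (k + 1) = sqrtCoeff (t + 1) (k + 1) - sqrtCoeff (t + 2) k / 4 := by
  cases k with
  | zero => simp [sqrtCoeff, poch_zero_right]; ring
  | succ k =>
    have h1 : (k + 1 : ℂ) ≠ 0 := by exact_mod_cast k.succ_ne_zero
    have h2 : (k + 2 : ℂ) ≠ 0 := by exact_mod_cast (k + 1).succ_ne_zero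
    have h3 : (k.factorial : ℂ) ≠ 0 := by exact_mod_cast k.factorial_ne_zero
    simp only [sqrtCoeff, Nat.factorial_succ]
    rw [poch_succ' (t + _ + 2), poch_succ (t + 1 + _ + 2)]
    push_cast
    rw [show t + (k + 1) + 2 + 1 = t + 2 + k + 2 by ring, show t + 1 + (k + 1) + 2 = t + 2 + k + 2 by ring]
    have h4 : (k + 1 + 1 : ℂ) ≠ 0 := by convert h2 using 1; ring
    field_simp
    ring

/-- The exponent -3/2, independent of t, reflects the square-root branch point at w = 1. The
quotient formula gives it for Re t > -1, where (t+1)_k does not vanish, and the recurrence carries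
it to the left. -/
theorem sqrtCoeff_isBigO (t : ℂ) :
    sqrtCoeff t =O[atTop] fun k : ℕ => ((k : ℝ) + 1) ^ (-(3 / 2) : ℝ) := by
  suffices ∀ N : ℕ, ∀ t : ℂ, -1 - (N : ℝ) < t.re →
      sqrtCoeff t =O[atTop] fun k : ℕ => ((k : ℝ) + 1) ^ (-(3 / 2) : ℝ) by
    obtain ⟨N, hN⟩ := exists_nat_gt (-t.re)
    exact this N t (by linarith)
  intro N
  induction N with
  | zero =>
    intro t ht
    have ht' : ∀ m : ℕ, t + 1 ≠ -m := by
      intro m h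
      have := congrArg Complex.re h
      simp at this ht
      have : (0 : ℝ) ≤ m := m.cast_nonneg
      linarith
    have h := ((binCoeff_isBigO (t / 2)).mul (binCoeff_isBigO ((t + 1) / 2))).mul
      ((factorial_mul_inv_Gamma_isBigO (t + 1)).const_mul_left (Complex.Gamma (t + 1)))
    refine h.congr' ?_ ?_
    · refine Eventually.of_forall fun k => ?_
      have h1 := poch_ne_zero ht' k
      have h3 : (k.factorial : ℂ) ≠ 0 := by exact_mod_cast k.factorial_ne_zero
      have h7 := Complex.Gamma_add_nat_div_Gamma_eq (t + 1) (n := k) ht'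
      have h8 := Complex.Gamma_ne_zero ht'
      rw [div_eq_iff h8] at h7
      simp only
      rw [h7, sqrtCoeff_eq t k h1, binCoeff, binCoeff]
      field_simp
    · refine Eventually.of_forall fun k => ?_
      simp only
      rw [← Real.rpow_add (by positivity), ← Real.rpow_add (by positivity)]
      congr 1
      simp
      ring
  | succ N ih =>
    intro t ht
    push_cast at ht
    have h1 := ih (t + 1) (by simp; linarith)
    have h2 := ih (t + 2) (by simp; linarith)
    have h3 : (fun k : ℕ => ((k : ℝ) + 1) ^ (-(3 / 2) : ℝ)) =O[atTop]
        fun k : ℕ => (k : ℝ) ^ (-(3 / 2) : ℝ) := by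
      refine IsBigO.of_bound 1 ?_
      filter_upwards [eventually_ge_atTop 1] with k hk
      have hk' : (1 : ℝ) ≤ k := by exact_mod_cast hk
      rw [Real.norm_of_nonneg (by positivity), Real.norm_of_nonneg (by positivity), one_mul]
      exact Real.rpow_le_rpow_of_nonpos (by linarith) (by linarith) (by norm_num)
    refine isBigO_add_one_rpow_of_shift ?_
    simp only [sqrtCoeff_recurrence t]
    refine IsBigO.sub (IsBigO.trans ?_ h3) ?_
    · refine (h1.comp_tendsto (tendsto_add_atTop_nat 1)).trans (IsBigO.of_bound 1 ?_)
      refine Eventually.of_forall fun k => ?_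
      simp only [Function.comp]
      rw [Real.norm_of_nonneg (by positivity), Real.norm_of_nonneg (by positivity), one_mul]
      refine Real.rpow_le_rpow_of_nonpos (by positivity) (by push_cast; linarith) (by norm_num)
    · exact ((h2.trans h3).const_mul_left 4⁻¹).congr_left fun k => by ring

theorem summable_norm_of_isBigO {f : ℕ → ℂ} {p : ℝ} (hp : p < -1)
    (h : f =O[atTop] fun k : ℕ => ((k : ℝ) + 1) ^ p) : Summable fun k => ‖f k‖ := by
  refine summable_of_isBigO_nat ?_ h.norm_left
  have := (summable_nat_add_iff 1).2 (Real.summable_nat_rpow.2 hp)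
  simpa using this

theorem summable_norm_sqrtCoeff (t : ℂ) : Summable fun k => ‖sqrtCoeff t k‖ :=
  summable_norm_of_isBigO (by norm_num) (sqrtCoeff_isBigO t)

theorem exists_bound_of_isBigO {f : ℕ → ℂ} {p : ℝ}
    (h : f =O[atTop] fun k : ℕ => ((k : ℝ) + 1) ^ p) :
    ∃ C > 0, ∀ k, ‖f k‖ ≤ C * ((k : ℝ) + 1) ^ p := by
  obtain ⟨C, hC, h⟩ := bound_of_isBigO_nat_atTop h
  refine ⟨C, hC, fun k => ?_⟩
  have hk : 0 < ((k : ℝ) + 1) ^ p := by positivity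
  simpa [abs_of_pos hk] using h hk.ne'

theorem exists_pow_bound_of_isBigO {f : ℕ → ℂ} {p : ℝ}
    (h : f =O[atTop] fun k : ℕ => ((k : ℝ) + 1) ^ p) :
    ∃ C > 0, ∃ A : ℕ, ∀ k, ‖f k‖ ≤ C * ((k : ℝ) + 1) ^ A := by
  obtain ⟨C, hC, h⟩ := exists_bound_of_isBigO h
  obtain ⟨A, hA⟩ := exists_nat_ge p
  refine ⟨C, hC, A, fun k => (h k).trans ?_⟩
  rw [← Real.rpow_natCast]
  gcongr
  linarith [(k.cast_nonneg : (0 : ℝ) ≤ k)]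

theorem summable_add_one_pow_mul_pow (A : ℕ) {r : ℝ} (h0 : 0 ≤ r) (h1 : r < 1) :
    Summable fun k : ℕ => ((k : ℝ) + 1) ^ A * r ^ k := by
  have h := summable_pow_mul_geometric_of_norm_lt_one A (r := r) (by rwa [Real.norm_of_nonneg h0])
  refine summable_of_isBigO_nat (h.mul_left (2 ^ A)) (IsBigO.of_bound 1 ?_)
  filter_upwards [eventually_ge_atTop 1] with k hk
  have hk' : (1 : ℝ) ≤ k := by exact_mod_cast hk
  rw [Real.norm_of_nonneg (by positivity), Real.norm_of_nonneg (by positivity), one_mul,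
    ← mul_assoc, ← mul_pow]
  gcongr
  linarith

theorem summable_norm_mul_pow_of_isBigO {f : ℕ → ℂ} {p : ℝ}
    (h : f =O[atTop] fun k : ℕ => ((k : ℝ) + 1) ^ p) {r : ℝ} (h0 : 0 ≤ r) (h1 : r < 1) :
    Summable fun k => ‖f k‖ * r ^ k := by
  obtain ⟨C, hC, A, hA⟩ := exists_pow_bound_of_isBigO h
  refine Summable.of_nonneg_of_le (fun k => by positivity) (fun k => ?_)
    ((summable_add_one_pow_mul_pow A h0 h1).mul_left C)
  rw [← mul_assoc]
  gcongr
  exact hA k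

end

/-! ### Rearrangement of double series -/

section

open Filter Asymptotics Topology Finset

theorem hasSum_tsum_antidiagonal {f : ℕ × ℕ → ℂ} (hf : Summable f) :
    HasSum (fun n => ∑' k, f (n, k)) (∑' m, ∑ p ∈ HasAntidiagonal.antidiagonal m, f p) := by
  have h1 := hf.hasSum.prod_fiberwise fun n => (hf.prod_factor n).hasSum
  convert h1 using 1
  rw [← HasAntidiagonal.sigmaAntidiagonalEquivProd.tsum_eq f]
  refine Eq.trans (tsum_congr fun m => ?_)
    ((HasAntidiagonal.sigmaAntidiagonalEquivProd.summable_iff.2 hf).tsum_sigma'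
      fun n => (hasSum_fintype _).summable).symm
  rw [tsum_fintype]
  exact (Finset.sum_coe_sort (HasAntidiagonal.antidiagonal m) f).symm

/-- `(β)_m / Γ(c + m)`. -/
noncomputable def hypWeight (β c : ℂ) (m : ℕ) : ℂ := poch β m * (Complex.Gamma (c + m))⁻¹

theorem regHyp_comm (a b c w : ℂ) : regHyp a b c w = regHyp b a c w := by
  simp only [regHyp, mul_comm (poch a _)]

theorem regHyp_eq_tsum_hypWeight (a b c w : ℂ) :
    regHyp a b c w = ∑' k, binCoeff b k * hypWeight a c k * w ^ k := by
  refine tsum_congr fun k => ?_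
  rw [binCoeff, hypWeight]
  ring

/-- Since (β)_n (β+n)_k = (β)_{n+k}, the weight depends on n+k only, which is what makes summation
along antidiagonals useful. -/
theorem pow_mul_poch_mul_regHyp (β b c w z : ℂ) (n : ℕ) :
    z ^ n * poch β n * regHyp b (β + n) (c + n) w =
      ∑' k, binCoeff b k * hypWeight β c (n + k) * z ^ n * w ^ k := by
  rw [regHyp_comm, regHyp_eq_tsum_hypWeight, ← tsum_mul_left]
  refine tsum_congr fun k => ?_
  rw [hypWeight, hypWeight, poch_add]
  push_cast
  rw [add_assoc c]
  ring

/-- Rearrangement of a series of regularized Gauss functions with shifted parameters. -/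
theorem hasSum_regHyp_of_summable {β c d z e e' : ℂ} {q b : ℕ → ℂ}
    (hS : Summable fun p : ℕ × ℕ => q p.1 * binCoeff (b p.1) p.2 * hypWeight β c (p.1 + p.2) *
      z ^ p.1 * (e * z) ^ p.2)
    (hq : ∀ m, ∑ p ∈ HasAntidiagonal.antidiagonal m, q p.1 * (e ^ p.2 * binCoeff (b p.1) p.2) =
      e' ^ m * binCoeff d m) :
    HasSum (fun n => q n * (z ^ n * poch β n * regHyp (b n) (β + n) (c + n) (e * z)))
      (regHyp d β c (e' * z)) := by
  convert hasSum_tsum_antidiagonal hS using 1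
  · ext n
    rw [pow_mul_poch_mul_regHyp, ← tsum_mul_left]
    exact tsum_congr fun k => by ring
  · rw [regHyp_comm, regHyp_eq_tsum_hypWeight]
    refine tsum_congr fun m => ?_
    rw [show binCoeff d m * hypWeight β c m * (e' * z) ^ m =
      hypWeight β c m * z ^ m * (e' ^ m * binCoeff d m) by rw [mul_pow]; ring, ← hq, mul_sum]
    refine sum_congr rfl fun p hp => ?_
    rw [← HasAntidiagonal.mem_antidiagonal.1 hp, pow_add, mul_pow]
    ring

theorem hypWeight_isBigO (β c : ℂ) :
    hypWeight β c =O[atTop] fun k : ℕ => ((k : ℝ) + 1) ^ (β.re - c.re) := by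
  refine ((binCoeff_isBigO β).mul (factorial_mul_inv_Gamma_isBigO c)).congr (fun k => ?_)
    fun k => ?_
  · have h3 : (k.factorial : ℂ) ≠ 0 := by exact_mod_cast k.factorial_ne_zero
    rw [hypWeight, binCoeff]
    field_simp
  · rw [← Real.rpow_add (by positivity)]
    ring_nf

theorem exists_norm_mul_pow_le {f : ℕ → ℂ} {p : ℝ}
    (h : f =O[atTop] fun k : ℕ => ((k : ℝ) + 1) ^ p) {r r' : ℝ} (h0 : 0 ≤ r) (h1 : r < r') :
    ∃ C > 0, ∀ k, ‖f k‖ * r ^ k ≤ C * r' ^ k := by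
  have hr' : 0 < r' := h0.trans_lt h1
  have hs := summable_norm_mul_pow_of_isBigO h (r := r / r') (by positivity)
    ((div_lt_one hr').2 h1)
  refine ⟨∑' k, ‖f k‖ * (r / r') ^ k + 1, by positivity, fun k => ?_⟩
  have := hs.le_tsum k fun j _ => by positivity
  rw [div_pow, mul_div_assoc', div_le_iff₀ (by positivity)] at this
  nlinarith [pow_pos hr' k]

theorem summable_norm_antidiagonal_mul_pow {f g : ℕ → ℂ} {r : ℝ} (hr : 0 ≤ r)
    (hf : Summable fun k => ‖f k‖ * r ^ k) (hg : Summable fun k => ‖g k‖ * r ^ k) :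
    Summable fun n => ‖∑ p ∈ HasAntidiagonal.antidiagonal n, f p.1 * g p.2‖ * r ^ n := by
  have e : ∀ h : ℕ → ℂ, ∀ k, ‖h k‖ * r ^ k = ‖h k * (r : ℂ) ^ k‖ := fun h k => by
    rw [norm_mul, norm_pow, Complex.norm_of_nonneg hr]
  simp only [e] at hf hg
  refine (summable_norm_sum_mul_antidiagonal_of_summable_norm hf hg).congr fun n => ?_
  rw [e (fun n => ∑ p ∈ HasAntidiagonal.antidiagonal n, f p.1 * g p.2), sum_mul]
  refine congrArg _ (sum_congr rfl fun p hp => ?_)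
  rw [← HasAntidiagonal.mem_antidiagonal.1 hp, pow_add]
  ring

theorem clausenPoly_one_eq (n : ℕ) (ρ τ : ℂ) : clausenPoly n ρ τ 1 =
    ∑ p ∈ HasAntidiagonal.antidiagonal n, binCoeff ρ p.1 * sqrtCoeff τ p.2 := by
  rw [clausenPoly, ← Nat.sum_antidiagonal_swap, Nat.sum_antidiagonal_eq_sum_range_succ_mk]
  simp [binCoeff]

theorem batemanPoly_eq (n : ℕ) (τ r : ℂ) : batemanPoly n τ r =
    ∑ p ∈ HasAntidiagonal.antidiagonal n, (-1) ^ p.1 * binCoeff (-r - τ) p.1 * binCoeff τ p.2 := by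
  have h := congrArg (PowerSeries.coeff n) (mk_batemanPoly τ r)
  rw [PowerSeries.coeff_mul, PowerSeries.coeff_mk] at h
  rw [h]
  simp [altBinSeries, binSeries]

theorem summable_norm_binCoeff_mul_pow (a : ℂ) {r : ℝ} (h0 : 0 ≤ r) (h1 : r < 1) :
    Summable fun k => ‖binCoeff a k‖ * r ^ k :=
  summable_norm_mul_pow_of_isBigO (binCoeff_isBigO a) h0 h1

theorem summable_norm_batemanPoly_mul_pow (τ s : ℂ) {r : ℝ} (h0 : 0 ≤ r) (h1 : r < 1) :
    Summable fun k => ‖batemanPoly k τ s‖ * r ^ k := by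
  simp only [batemanPoly_eq]
  refine summable_norm_antidiagonal_mul_pow (f := fun k => (-1) ^ k * binCoeff (-s - τ) k) h0 ?_
    (summable_norm_binCoeff_mul_pow τ h0 h1)
  simpa using summable_norm_binCoeff_mul_pow (-s - τ) h0 h1

theorem summable_norm_clausenPoly_mul_pow (ρ τ : ℂ) {r : ℝ} (h0 : 0 ≤ r) (h1 : r < 1) :
    Summable fun k => ‖clausenPoly k ρ τ 1‖ * r ^ k := by
  simp only [clausenPoly_one_eq]
  exact summable_norm_antidiagonal_mul_pow h0 (summable_norm_binCoeff_mul_pow ρ h0 h1)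
    (summable_norm_mul_pow_of_isBigO (sqrtCoeff_isBigO τ) h0 h1)

/-- The weight decreases because Re ν > -1, so in the convolution defining 𝔭_n it may be moved onto
the binomial factor. That factor then has order -(3/2) Re ν - 2, which is below -1 exactly when Re ν
> -2/3; the other factor is summable by itself. -/
theorem summable_norm_clausenPoly_mul_rpow (ν τ : ℂ) (hν : -(2 / 3) < ν.re) :
    Summable fun n : ℕ => ‖clausenPoly n (-ν / 2) τ 1‖ * ((n : ℝ) + 1) ^ (-ν.re - 1) := by
  have h1 : Summable fun k : ℕ => ‖binCoeff (-ν / 2) k * (((k : ℝ) + 1) ^ (-ν.re - 1) : ℝ)‖ := by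
    refine summable_norm_of_isBigO (p := -(3 / 2) * ν.re - 2) (by linarith) ?_
    have h2 : (fun k : ℕ => ((((k : ℝ) + 1) ^ (-ν.re - 1) : ℝ) : ℂ)) =O[atTop]
        fun k : ℕ => ((k : ℝ) + 1) ^ (-ν.re - 1) :=
      IsBigO.of_bound 1 (Eventually.of_forall fun k => by simp)
    refine ((binCoeff_isBigO (-ν / 2)).mul h2).congr_right fun k => ?_
    rw [← Real.rpow_add (by positivity)]
    congr 1
    simp
    ring
  have h3 := summable_norm_sum_mul_antidiagonal_of_summable_norm h1.norm
    (summable_norm_sqrtCoeff τ).norm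
  refine Summable.of_nonneg_of_le (fun k => by positivity) (fun n => ?_) h3
  rw [Real.norm_of_nonneg (sum_nonneg fun p _ => by positivity), clausenPoly_one_eq]
  refine (mul_le_mul_of_nonneg_right (norm_sum_le _ _) (by positivity)).trans ?_
  rw [sum_mul]
  refine sum_le_sum fun p hp => ?_
  have hp' : (p.1 : ℝ) ≤ n := by
    exact_mod_cast (HasAntidiagonal.mem_antidiagonal.1 hp) ▸ Nat.le_add_right _ _
  rw [norm_mul, norm_mul, Complex.norm_of_nonneg (by positivity), mul_right_comm]
  gcongr ‖_‖ * ?_ * ‖_‖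
  exact Real.rpow_le_rpow_of_nonpos (by positivity) (by linarith) (by linarith)

theorem norm_binCoeff_le {a : ℂ} {t : ℕ} (h : ‖a‖ ≤ t + 1) (k : ℕ) :
    ‖binCoeff a k‖ ≤ (k + t).choose t := by
  induction k with
  | zero => simp [binCoeff_zero_right]
  | succ k ih =>
    have h1 := congrArg norm (binCoeff_succ a k)
    have e : ‖(k + 1 : ℂ)‖ = k + 1 := by exact_mod_cast Complex.norm_natCast (k + 1)
    rw [norm_mul, norm_mul, e] at h1
    have h2 : (((k + 1 + t).choose t : ℕ) : ℝ) * (k + 1) = (t + 1 + k) * ((k + t).choose t : ℕ) := by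
      have := Nat.add_one_mul_choose_eq (k + t) k
      rw [Nat.choose_symm_add, show k + t + 1 = k + 1 + t by ring, Nat.choose_symm_add] at this
      have h' : ((k + 1 + t : ℕ) : ℝ) * ((k + t).choose t : ℕ) =
        ((k + 1 + t).choose t : ℕ) * (k + 1 : ℕ) := by exact_mod_cast this
      push_cast at h' ⊢
      linarith
    refine le_of_mul_le_mul_right ?_ (by positivity : (0 : ℝ) < k + 1)
    rw [h1, h2]
    gcongr
    refine (norm_add_le _ _).trans ?_
    simpa using h

/-- The coefficients of (1-z)^{-b_n} are majorized by those with the integer exponent S+ln+1, whose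
sum over k is closed: (1-r)^{-(S+ln+1)}. The remaining ratio in n is r/(1-r)^l. The Clausen series
uses l = 2, Pfaff's transformation l = 1. -/
theorem summable_mul_binCoeff_double {q b : ℕ → ℂ} {g : ℕ → ℕ → ℂ} {ω : ℕ → ℝ} {r : ℝ} {S l : ℕ}
    (h0 : 0 ≤ r) (h1 : r < 1) (hg : ∀ n k, ‖g n k‖ ≤ ω n * r ^ (n + k))
    (hb : ∀ n : ℕ, ‖b n‖ ≤ S + l * n)
    (hq : Summable fun n => ‖q n‖ * ω n * (r / (1 - r) ^ l) ^ n) :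
    Summable fun p : ℕ × ℕ => q p.1 * binCoeff (b p.1) p.2 * g p.1 p.2 := by
  have hω : ∀ n, 0 ≤ ω n * r ^ n := fun n => (norm_nonneg _).trans (by simpa using hg n 0)
  have hb' : ∀ n k : ℕ, ‖binCoeff (b n) k‖ ≤ (k + (S + l * n)).choose (S + l * n) :=
    fun n k => norm_binCoeff_le ((hb n).trans (by push_cast; linarith)) k
  have hc : ∀ n : ℕ, HasSum (fun k : ℕ => ((k + (S + l * n)).choose (S + l * n) : ℝ) * r ^ k)
      (1 / (1 - r) ^ (S + l * n + 1)) := fun n =>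
    hasSum_choose_mul_geometric_of_norm_lt_one (S + l * n) (by rwa [Real.norm_of_nonneg h0])
  refine Summable.of_norm_bounded (g := fun p : ℕ × ℕ => ‖q p.1‖ * (ω p.1 * r ^ p.1) *
    (((p.2 + (S + l * p.1)).choose (S + l * p.1) : ℝ) * r ^ p.2)) ?_ ?_
  · refine (summable_prod_of_nonneg fun p =>
      mul_nonneg (mul_nonneg (norm_nonneg _) (hω _)) (by positivity)).2 ⟨fun n => ?_, ?_⟩
    · simp only
      exact (hc n).summable.mul_left _
    · simp only [tsum_mul_left, (hc _).tsum_eq]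
      refine (hq.mul_right (1 / (1 - r) ^ (S + 1))).congr fun n => ?_
      have : (1 - r) ≠ 0 := by linarith
      rw [div_pow, ← pow_mul, show S + l * n + 1 = l * n + (S + 1) by ring, pow_add]
      field_simp
      ring
  · rintro ⟨n, k⟩
    rw [norm_mul, norm_mul]
    calc ‖q n‖ * ‖binCoeff (b n) k‖ * ‖g n k‖
        ≤ ‖q n‖ * ((k + (S + l * n)).choose (S + l * n)) * (ω n * r ^ (n + k)) := by
          gcongr
          · exact hb' n k
          · exact hg n k
      _ = _ := by rw [pow_add]; ring

theorem exists_nat_norm_add_mul_le (s : ℂ) (l : ℕ) : ∃ S : ℕ, ∀ n : ℕ, ‖s + l * n‖ ≤ S + l * n := by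
  obtain ⟨S, hS⟩ := exists_nat_ge ‖s‖
  refine ⟨S, fun n => (norm_add_le _ _).trans ?_⟩
  simpa using hS

/-- The inner exponent -ν does not depend on n, so the majorant is a product of two single series
and |z| < 1 suffices. -/
theorem hasSum_bateman (μ ν : ℂ) {z : ℂ} (hz : ‖z‖ < 1) :
    HasSum (fun n => batemanPoly n ν (-2 * μ) *
        (z ^ n * poch (μ - ν) n * regHyp (-ν) (μ - ν + n) (1 + μ + n) z))
      (regHyp (2 * μ - ν) (μ - ν) (1 + μ) (-z)) := by
  obtain ⟨r, hr, hr1⟩ := exists_between hz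
  have hr0 := (norm_nonneg z).trans hr.le
  obtain ⟨C, hC, hCb⟩ := exists_norm_mul_pow_le (hypWeight_isBigO (μ - ν) (1 + μ)) (norm_nonneg z) hr
  have := hasSum_regHyp_of_summable (β := μ - ν) (c := 1 + μ) (d := 2 * μ - ν) (z := z) (e := 1)
    (e' := -1) (q := fun n => batemanPoly n ν (-2 * μ)) (b := fun _ => -ν) ?_ fun m => by
      simpa using sum_antidiagonal_batemanPoly ν μ m
  · simpa using this
  · have h := ((summable_norm_batemanPoly_mul_pow ν (-2 * μ) hr0 hr1).mul_of_nonneg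
      (summable_norm_binCoeff_mul_pow (-ν) hr0 hr1) (fun k => by positivity)
      fun k => by positivity).mul_left C
    refine Summable.of_norm_bounded h ?_
    rintro ⟨n, k⟩
    have := hCb (n + k)
    simp only [one_mul, norm_mul, norm_pow]
    calc _ = ‖batemanPoly n ν (-2 * μ)‖ * ‖binCoeff (-ν) k‖ *
          (‖hypWeight (μ - ν) (1 + μ) (n + k)‖ * ‖z‖ ^ (n + k)) := by rw [pow_add]; ring
      _ ≤ ‖batemanPoly n ν (-2 * μ)‖ * ‖binCoeff (-ν) k‖ * (C * r ^ (n + k)) := by gcongr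
      _ = _ := by rw [pow_add]; ring

theorem hasSum_clausen_of_summable {μ ν z : ℂ}
    (hS : Summable fun p : ℕ × ℕ => 4 ^ p.1 * clausenPoly p.1 (-ν / 2) (2 * μ) 1 *
      binCoeff (2 * μ - ν + 2 * p.1) p.2 *
        (hypWeight (μ - ν) (1 + μ) (p.1 + p.2) * z ^ p.1 * (-z) ^ p.2)) :
    HasSum (fun n => 4 ^ n * clausenPoly n (-ν / 2) (2 * μ) 1 *
        (z ^ n * poch (μ - ν) n * regHyp (2 * μ - ν + 2 * n) (μ - ν + n) (1 + μ + n) (-z)))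
      (regHyp (-ν) (μ - ν) (1 + μ) z) := by
  have := hasSum_regHyp_of_summable (β := μ - ν) (c := 1 + μ) (d := -ν) (z := z) (e := -1)
    (e' := 1) (q := fun n => 4 ^ n * clausenPoly n (-ν / 2) (2 * μ) 1)
    (b := fun n => 2 * μ - ν + 2 * n) ?_ fun m => by
      simpa using sum_antidiagonal_clausenPoly ν μ m
  · simpa using this
  · refine hS.congr fun p => ?_
    rw [neg_one_mul]
    ring

theorem hasSum_clausen_of_lt (μ ν : ℂ) {z : ℂ} (hz1 : ‖z‖ < 1) (hz : 4 * ‖z‖ < (1 - ‖z‖) ^ 2) :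
    HasSum (fun n => 4 ^ n * clausenPoly n (-ν / 2) (2 * μ) 1 *
        (z ^ n * poch (μ - ν) n * regHyp (2 * μ - ν + 2 * n) (μ - ν + n) (1 + μ + n) (-z)))
      (regHyp (-ν) (μ - ν) (1 + μ) z) := by
  -- A radius slightly larger than |z| absorbs the polynomial growth of the weight.
  obtain ⟨r, hzr, hr1, hr⟩ : ∃ r, ‖z‖ < r ∧ r < 1 ∧ 4 * r < (1 - r) ^ 2 := by
    have h1 : ∀ᶠ r in 𝓝[>] ‖z‖, 4 * r < (1 - r) ^ 2 := by
      refine nhdsWithin_le_nhds (ContinuousAt.eventually_lt ?_ ?_ hz) <;> fun_prop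
    have h2 : ∀ᶠ r in 𝓝[>] ‖z‖, r < 1 := nhdsWithin_le_nhds (eventually_lt_nhds hz1)
    obtain ⟨r, h3, h4, h5⟩ := (h1.and (h2.and self_mem_nhdsWithin)).exists
    exact ⟨r, h5, h4, h3⟩
  have hr0 := (norm_nonneg z).trans hzr.le
  obtain ⟨C, hC, hCb⟩ := exists_norm_mul_pow_le (hypWeight_isBigO (μ - ν) (1 + μ)) (norm_nonneg z) hzr
  obtain ⟨S, hS⟩ := exists_nat_norm_add_mul_le (2 * μ - ν) 2
  have hq : 0 < (1 - r) ^ 2 := by nlinarith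
  refine hasSum_clausen_of_summable (summable_mul_binCoeff_double
    (b := fun n => 2 * μ - ν + 2 * n) (l := 2) (S := S) (q := fun n => 4 ^ n * clausenPoly n (-ν / 2) (2 * μ) 1)
    (g := fun n k => hypWeight (μ - ν) (1 + μ) (n + k) * z ^ n * (-z) ^ k)
    (ω := fun _ => C) hr0 hr1 (fun n k => ?_) (by simpa using hS) ?_)
  · simp only [norm_mul, norm_pow, norm_neg]
    rw [mul_assoc, ← pow_add]
    exact hCb _
  · have h := (summable_norm_clausenPoly_mul_pow (-ν / 2) (2 * μ) (r := 4 * r / (1 - r) ^ 2)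
      (by positivity) ((div_lt_one hq).2 hr)).mul_left C
    refine h.congr fun n => ?_
    rw [norm_mul, norm_pow, mul_div_assoc, mul_pow]
    simp
    ring

/-- On the boundary |z| cannot be enlarged, so the decay (n+k+1)^{-Re ν-1} of the weight is kept and
bounded by its value at k = 0. -/
theorem hasSum_clausen_of_eq {μ ν z : ℂ} (hν : -(2 / 3) < ν.re) (hz1 : ‖z‖ < 1)
    (hz : 4 * ‖z‖ = (1 - ‖z‖) ^ 2) :
    HasSum (fun n => 4 ^ n * clausenPoly n (-ν / 2) (2 * μ) 1 *
        (z ^ n * poch (μ - ν) n * regHyp (2 * μ - ν + 2 * n) (μ - ν + n) (1 + μ + n) (-z)))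
      (regHyp (-ν) (μ - ν) (1 + μ) z) := by
  have hw := hypWeight_isBigO (μ - ν) (1 + μ)
  rw [show (μ - ν).re - (1 + μ).re = -ν.re - 1 by simp; ring] at hw
  obtain ⟨C, hC, hCb⟩ := exists_bound_of_isBigO hw
  obtain ⟨S, hS⟩ := exists_nat_norm_add_mul_le (2 * μ - ν) 2
  have hq : (1 - ‖z‖) ^ 2 ≠ 0 := pow_ne_zero 2 (by linarith)
  refine hasSum_clausen_of_summable (summable_mul_binCoeff_double
    (b := fun n => 2 * μ - ν + 2 * n) (l := 2) (S := S) (q := fun n => 4 ^ n * clausenPoly n (-ν / 2) (2 * μ) 1)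
    (g := fun n k => hypWeight (μ - ν) (1 + μ) (n + k) * z ^ n * (-z) ^ k)
    (ω := fun n => C * ((n : ℝ) + 1) ^ (-ν.re - 1)) (norm_nonneg z) hz1
    (fun n k => ?_) (by simpa using hS) ?_)
  · simp only [norm_mul, norm_pow, norm_neg]
    rw [mul_assoc, ← pow_add]
    gcongr
    refine (hCb _).trans ?_
    gcongr C * ?_
    refine Real.rpow_le_rpow_of_nonpos (by positivity) ?_ (by linarith)
    push_cast
    linarith [(k.cast_nonneg : (0 : ℝ) ≤ k)]
  · refine ((summable_norm_clausenPoly_mul_rpow ν (2 * μ) hν).mul_left C).congr fun n => ?_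
    have : (4 : ℝ) ^ n * (‖z‖ / (1 - ‖z‖) ^ 2) ^ n = 1 := by
      rw [← mul_pow, mul_div_assoc', hz, div_self hq, one_pow]
    rw [norm_mul, norm_pow, Complex.norm_ofNat]
    linear_combination (-C * ‖clausenPoly n (-ν / 2) (2 * μ) 1‖ * ((n : ℝ) + 1) ^ (-ν.re - 1)) * this

/-- Here (μ-ν)_m = 0 for m > N, so the double series is a finite sum. -/
theorem hasSum_clausen_of_natCast {μ ν : ℂ} {N : ℕ} (h : ν - μ = N) (z : ℂ) :
    HasSum (fun n => 4 ^ n * clausenPoly n (-ν / 2) (2 * μ) 1 *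
        (z ^ n * poch (μ - ν) n * regHyp (2 * μ - ν + 2 * n) (μ - ν + n) (1 + μ + n) (-z)))
      (regHyp (-ν) (μ - ν) (1 + μ) z) := by
  refine hasSum_clausen_of_summable
    (summable_of_ne_finset_zero (s := range (N + 1) ×ˢ range (N + 1)) ?_)
  rintro ⟨n, k⟩ hp
  have h0 : hypWeight (μ - ν) (1 + μ) (n + k) = 0 := by
    obtain ⟨l, hl⟩ : ∃ l, n + k = N + 1 + l := by
      refine Nat.exists_eq_add_of_le ?_
      simp only [mem_product, mem_range] at hp
      omega
    rw [hypWeight, hl, poch_add, poch_succ, show μ - ν = -N by rw [← h]; ring]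
    simp
  simp [h0]

end

/-! ### Pfaff's transformation and estimates uniform in n -/

section

open Filter Asymptotics Topology Finset

theorem ringChoose_eq_binCoeff (a : ℂ) (n : ℕ) : Ring.choose (a + n - 1) n = binCoeff a n := by
  have h3 : (n.factorial : ℂ) ≠ 0 := by exact_mod_cast n.factorial_ne_zero
  have h := Ring.factorial_nsmul_multichoose_eq_ascPochhammer a n
  rw [Polynomial.ascPochhammer_smeval_eq_eval, nsmul_eq_mul] at h
  rw [Ring.choose, show a + n - 1 - n + 1 = a by ring, binCoeff, poch, ← h]
  field_simp

theorem hasSum_one_add_cpow_neg (a : ℂ) {z : ℂ} (hz : ‖z‖ < 1) :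
    HasSum (fun n => binCoeff a n * (-z) ^ n) ((1 + z) ^ (-a)) := by
  have h := (Complex.one_div_one_sub_cpow_hasFPowerSeriesOnBall_zero a).hasSum (y := -z)
    (by rw [mem_eball_zero_iff, enorm_neg, ← ofReal_norm]; exact ENNReal.ofReal_lt_one.2 hz)
  simp only [FormalMultilinearSeries.ofScalars_apply_eq, ringChoose_eq_binCoeff, zero_add,
    sub_neg_eq_add, smul_eq_mul] at h
  rwa [Complex.cpow_neg, ← one_div]

/-- One difference in k of (d)_k / Γ(c+k) gives back the same expression with c+1 for c, times
-(c-d). Iteration yields the regularized Chu–Vandermonde sum. -/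
theorem fwdDiff_iter_hypWeight (d : ℂ) (m : ℕ) : ∀ c : ℂ,
    (fwdDiff 1)^[m] (hypWeight d c) 0 = (-1) ^ m * poch (c - d) m * (Complex.Gamma (c + m))⁻¹ := by
  induction m with
  | zero => intro c; simp [hypWeight, poch_zero_right]
  | succ m ih =>
    intro c
    have : fwdDiff 1 (hypWeight d c) = -(c - d) • hypWeight d (c + 1) := by
      ext k
      have h := Complex.one_div_Gamma_eq_self_mul_one_div_Gamma_add_one (c + k)
      simp only [fwdDiff, Pi.smul_apply, smul_eq_mul, hypWeight]
      rw [poch_succ, h]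
      push_cast
      rw [show c + (k + 1) = c + k + 1 by ring, show c + 1 + k = c + k + 1 by ring]
      ring
    rw [Function.iterate_succ_apply, this, fwdDiff_iter_const_smul, Pi.smul_apply, ih, poch_succ',
      smul_eq_mul]
    push_cast
    rw [show c + (m + 1) = c + 1 + m by ring, show c - d + 1 = c + 1 - d by ring]
    ring

theorem sum_antidiagonal_hypWeight (d c : ℂ) (m : ℕ) :
    ∑ p ∈ HasAntidiagonal.antidiagonal m,
      binCoeff d p.1 * (Complex.Gamma (c + p.1))⁻¹ * ((-1) ^ p.2 / (p.2.factorial : ℂ)) =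
      (-1) ^ m * binCoeff (c - d) m * (Complex.Gamma (c + m))⁻¹ := by
  have h := fwdDiff_iter_hypWeight d m c
  have h4 : (m.factorial : ℂ) ≠ 0 := by exact_mod_cast m.factorial_ne_zero
  rw [fwdDiff_iter_eq_sum_shift] at h
  rw [binCoeff, show (-1) ^ m * (poch (c - d) m / m.factorial) * (Complex.Gamma (c + m))⁻¹ =
    (m.factorial : ℂ)⁻¹ * ((-1) ^ m * poch (c - d) m * (Complex.Gamma (c + m))⁻¹) by ring, ← h,
    mul_sum, Nat.sum_antidiagonal_eq_sum_range_succ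
      (fun i j => binCoeff d i * (Complex.Gamma (c + i))⁻¹ * ((-1) ^ j / (j.factorial : ℂ)))]
  refine sum_congr rfl fun k hk => ?_
  obtain ⟨l, rfl⟩ := Nat.exists_eq_add_of_le (Nat.lt_succ_iff.1 (mem_range.1 hk))
  have h2 : (l.factorial : ℂ) ≠ 0 := by exact_mod_cast l.factorial_ne_zero
  have h3 : (k.factorial : ℂ) ≠ 0 := by exact_mod_cast k.factorial_ne_zero
  have h5 : ((k + l).choose k : ℂ) = ((k + l).factorial : ℂ) / (k.factorial * l.factorial) :=
    Nat.cast_add_choose ℂ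
  simp only [zsmul_eq_mul, nsmul_eq_mul, hypWeight, binCoeff, add_tsub_cancel_left]
  push_cast
  rw [h5]
  simp only [mul_one, zero_add]
  field_simp

theorem differentiableOn_regHyp (a b c : ℂ) :
    DifferentiableOn ℂ (regHyp a b c) (Metric.ball 0 1) := by
  intro z hz
  rw [mem_ball_zero_iff] at hz
  obtain ⟨r, hr, hr1⟩ := exists_between hz
  have hs : Summable fun k => ‖binCoeff b k * hypWeight a c k‖ * r ^ k := by
    refine summable_norm_mul_pow_of_isBigO (p := b.re - 1 + (a.re - c.re))
      (((binCoeff_isBigO b).mul (hypWeight_isBigO a c)).congr_right fun k => ?_)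
      ((norm_nonneg z).trans hr.le) hr1
    rw [← Real.rpow_add (by positivity)]
  have hd : DifferentiableOn ℂ (fun w => ∑' k, binCoeff b k * hypWeight a c k * w ^ k)
      (Metric.ball 0 r) := by
    refine Complex.differentiableOn_tsum_of_summable_norm hs (fun k => by fun_prop) Metric.isOpen_ball ?_
    intro k w hw
    rw [mem_ball_zero_iff] at hw
    rw [norm_mul, norm_pow]
    gcongr
  simp only [← regHyp_eq_tsum_hypWeight] at hd
  exact (hd.differentiableAt
    (Metric.isOpen_ball.mem_nhds (mem_ball_zero_iff.2 hr))).differentiableWithinAt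

theorem norm_one_add_sq (z : ℂ) : ‖1 + z‖ ^ 2 = 1 + 2 * z.re + ‖z‖ ^ 2 := by
  rw [Complex.sq_norm, Complex.sq_norm, Complex.normSq_apply, Complex.normSq_apply]
  simp
  ring

theorem norm_lt_one_of_two_mul_lt {z : ℂ} (h : 2 * ‖z‖ < ‖1 + z‖) : ‖z‖ < 1 := by
  have := norm_add_le 1 z
  rw [norm_one] at this
  linarith

/-- After squaring, the condition reads (1-κ^2)|z|^2 < κ^2 (1+2 Re z); scaling z by t ≤ 1 shrinks
the left side by t^2, and the right side becomes at least t times its old value. -/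
theorem starConvex_norm_lt {κ : ℝ} (h0 : 0 < κ) (h1 : κ < 1) :
    StarConvex ℝ 0 {z : ℂ | ‖z‖ < κ * ‖1 + z‖} := by
  rw [starConvex_zero_iff]
  intro z hz t ht0 ht1
  have hz' : ‖z‖ ^ 2 < κ ^ 2 * ‖1 + z‖ ^ 2 := by
    rw [← mul_pow]
    exact pow_lt_pow_left₀ hz (norm_nonneg _) two_ne_zero
  refine lt_of_pow_lt_pow_left₀ 2 (mul_nonneg h0.le (norm_nonneg _)) ?_
  rw [mul_pow, norm_one_add_sq] at *
  rw [norm_smul, Real.norm_of_nonneg ht0, Complex.real_smul, Complex.re_ofReal_mul]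
  have h2 : (κ ^ 2 - 1) * ‖z‖ ^ 2 ≤ 0 :=
    mul_nonpos_of_nonpos_of_nonneg (by nlinarith) (by positivity)
  have h3 : 0 < κ ^ 2 := by positivity
  rcases ht0.eq_or_lt with rfl | ht
  · simpa using h3
  · nlinarith [mul_lt_mul_of_pos_left hz' ht, mul_nonneg h3.le (sub_nonneg.2 ht1),
      mul_nonneg (mul_nonneg ht0 (sub_nonneg.2 ht1)) (neg_nonneg.2 h2)]

/-- After division by t, scaling replaces 1+|z|^2 on the right by 1/t + t|z|^2, which is no smaller
because (1-t)(1-t|z|^2) ≥ 0. -/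
theorem starConvex_koebe_lt {M : ℝ} (h0 : 0 < M) :
    StarConvex ℝ 0 {z : ℂ | ‖z‖ < 1 ∧ 4 * ‖z‖ < M * ‖1 + z‖ ^ 2} := by
  rw [starConvex_zero_iff]
  rintro z ⟨hz1, hz⟩ t ht0 ht1
  simp only [Set.mem_ofPred_eq]
  rw [norm_one_add_sq] at *
  rw [norm_smul, Real.norm_of_nonneg ht0, Complex.real_smul, Complex.re_ofReal_mul]
  refine ⟨by nlinarith [norm_nonneg z], ?_⟩
  have h3 : 0 ≤ (1 - t) * (1 - t * ‖z‖ ^ 2) :=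
    mul_nonneg (by linarith) (by nlinarith [norm_nonneg z, mul_nonneg ht0 (norm_nonneg z)])
  rcases ht0.eq_or_lt with rfl | ht
  · simpa using h0
  · nlinarith [mul_lt_mul_of_pos_left hz ht, mul_nonneg h0.le h3]

theorem one_add_ne_zero {z : ℂ} (hz : ‖z‖ < 1) : 1 + z ≠ 0 := by
  intro h
  rw [eq_neg_of_add_eq_zero_right h] at hz
  simp at hz

theorem differentiableAt_one_add_cpow (s : ℂ) {z : ℂ} (hz : ‖z‖ < 1) :
    DifferentiableAt ℂ (fun w => (1 + w) ^ s) z := by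
  refine DifferentiableAt.cpow_const (by fun_prop) (Or.inl ?_)
  have := (abs_lt.1 ((Complex.abs_re_le_norm z).trans_lt hz)).1
  simp
  linarith

theorem differentiableAt_regHyp_pfaff (a b c : ℂ) {z : ℂ} (hz : 2 * ‖z‖ < ‖1 + z‖) :
    DifferentiableAt ℂ (fun w => regHyp a b c (w / (1 + w))) z := by
  have h1 := one_add_ne_zero (norm_lt_one_of_two_mul_lt hz)
  have h2 : ‖z / (1 + z)‖ < 1 := by
    rw [norm_div, div_lt_one (norm_pos_iff.2 h1)]
    linarith [norm_nonneg z]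
  refine DifferentiableAt.comp (g := regHyp a b c) z ((differentiableOn_regHyp a b c).differentiableAt
    (Metric.isOpen_ball.mem_nhds (mem_ball_zero_iff.2 h2))) ?_
  fun_prop (disch := assumption)

/-- Expand each (1+z)^{-b-n} binomially and collect powers of z; the inner sums are Chu–Vandermonde
sums. -/
theorem regHyp_pfaff_of_norm_lt (a b c : ℂ) {z : ℂ} (hz : ‖z‖ < 1 / 3) :
    regHyp a b c (-z) = (1 + z) ^ (-b) * regHyp (c - a) b c (z / (1 + z)) := by
  have hz1 : ‖z‖ < 1 := hz.trans (by norm_num)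
  have h1 := one_add_ne_zero hz1
  obtain ⟨S, hS⟩ := exists_nat_norm_add_mul_le b 1
  have hs := summable_mul_binCoeff_double (b := fun n => b + n)
    (q := fun k => binCoeff (c - a) k * hypWeight b c k)
    (g := fun n k => z ^ n * (-z) ^ k) (ω := fun _ => 1) (r := ‖z‖) (S := S) (l := 1)
    (norm_nonneg z) hz1 (fun n k => by simp [pow_add]) (by simpa using hS) ?_
  · have h := (hasSum_tsum_antidiagonal hs).tsum_eq
    simp only at h
    have e1 : ∀ m, ∑ p ∈ HasAntidiagonal.antidiagonal m, binCoeff (c - a) p.1 * hypWeight b c p.1 *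
        binCoeff (b + p.1) p.2 * (z ^ p.1 * (-z) ^ p.2) =
        binCoeff b m * hypWeight a c m * (-z) ^ m := by
      intro m
      have h2 := sum_antidiagonal_hypWeight (c - a) c m
      rw [sub_sub_cancel] at h2
      have h3 : binCoeff b m * hypWeight a c m * (-z) ^ m = poch b m * z ^ m *
          ((-1) ^ m * binCoeff a m * (Complex.Gamma (c + m))⁻¹) := by
        rw [neg_pow z, binCoeff, binCoeff, hypWeight]
        ring
      rw [h3, ← h2, mul_sum]
      refine sum_congr rfl fun p hp => ?_
      rw [← HasAntidiagonal.mem_antidiagonal.1 hp, poch_add, neg_pow z, pow_add, hypWeight,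
        binCoeff.eq_1 (b + _)]
      ring
    have e2 : ∀ n : ℕ, ∑' k, binCoeff (c - a) n * hypWeight b c n * binCoeff (b + n) k *
        (z ^ n * (-z) ^ k) = (1 + z) ^ (-b) *
          (binCoeff (c - a) n * hypWeight b c n * (z / (1 + z)) ^ n) := by
      intro n
      have h2 := ((hasSum_one_add_cpow_neg (b + n) hz1).mul_left
        (binCoeff (c - a) n * hypWeight b c n * z ^ n)).tsum_eq
      rw [neg_add, Complex.cpow_add _ _ h1, Complex.cpow_neg _ (n : ℂ), Complex.cpow_natCast] at h2
      rw [div_pow, div_eq_mul_inv]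
      refine Eq.trans (tsum_congr fun k => ?_) (h2.trans ?_)
      · ring
      · ring
    simp only [e1, e2, tsum_mul_left] at h
    rw [regHyp_eq_tsum_hypWeight, regHyp_comm, regHyp_eq_tsum_hypWeight, h]
  · have h2 := (binCoeff_isBigO (c - a)).mul (hypWeight_isBigO b c)
    have h3 := summable_norm_mul_pow_of_isBigO (f := fun k => binCoeff (c - a) k * hypWeight b c k)
      (h2.congr_right fun k => by rw [← Real.rpow_add (by positivity)]) (r := ‖z‖ / (1 - ‖z‖))
      (div_nonneg (norm_nonneg z) (by linarith)) (by rw [div_lt_one] <;> linarith)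
    simpa using h3

/-- Pfaff's transformation. -/
theorem regHyp_pfaff (a b c : ℂ) {z : ℂ} (hz : 2 * ‖z‖ < ‖1 + z‖) :
    regHyp a b c (-z) = (1 + z) ^ (-b) * regHyp (c - a) b c (z / (1 + z)) := by
  -- On this set |z/(1+z)| < 1/2 and |z| < 1, so both sides are analytic; it is star-shaped about 0,
  -- so the identity theorem applies.
  set U : Set ℂ := {z : ℂ | ‖z‖ < 2⁻¹ * ‖1 + z‖}
  have hU : IsOpen U := isOpen_lt (by fun_prop) (by fun_prop)
  have hU' : ∀ w ∈ U, 2 * ‖w‖ < ‖1 + w‖ := fun w hw => by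
    have : ‖w‖ < 2⁻¹ * ‖1 + w‖ := hw
    linarith
  have h0 : (0 : ℂ) ∈ U := by simp [U]
  have hc : IsPreconnected U :=
    ((starConvex_norm_lt (by norm_num) (by norm_num)).isPathConnected h0).isConnected.isPreconnected
  refine AnalyticOnNhd.eqOn_of_preconnected_of_eventuallyEq (𝕜 := ℂ)
    (f := fun z => regHyp a b c (-z))
    (g := fun z => (1 + z) ^ (-b) * regHyp (c - a) b c (z / (1 + z)))
    (DifferentiableOn.analyticOnNhd ?_ hU) (DifferentiableOn.analyticOnNhd ?_ hU) hc h0 ?_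
    (show z ∈ U by simp only [U, Set.mem_ofPred_eq]; linarith)
  · intro w hw
    refine DifferentiableAt.differentiableWithinAt ?_
    refine DifferentiableAt.comp (g := regHyp a b c) w
      ((differentiableOn_regHyp a b c).differentiableAt (Metric.isOpen_ball.mem_nhds ?_)) (by fun_prop)
    rw [mem_ball_zero_iff, norm_neg]
    exact norm_lt_one_of_two_mul_lt (hU' w hw)
  · intro w hw
    exact ((differentiableAt_one_add_cpow _ (norm_lt_one_of_two_mul_lt (hU' w hw))).mul
      (differentiableAt_regHyp_pfaff _ _ _ (hU' w hw))).differentiableWithinAt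
  · filter_upwards [Metric.ball_mem_nhds (0 : ℂ) (by norm_num : (0 : ℝ) < 1 / 3)] with w hw
    exact regHyp_pfaff_of_norm_lt a b c (mem_ball_zero_iff.1 hw)

/-- Up to a polynomial factor due to s, (2n)_k is at most 2^k (n+k)!/n!. -/
theorem norm_poch_two_mul_le {s : ℂ} {S : ℕ} (hS : ‖s‖ ≤ S) (n k : ℕ) :
    ‖poch (s + 2 * n) k‖ * n.factorial ≤ 2 ^ k * (n + k).factorial * ((n : ℝ) + k + 1) ^ S := by
  induction k with
  | zero =>
    simp only [poch_zero_right, norm_one, pow_zero, add_zero, one_mul, Nat.cast_zero]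
    refine le_mul_of_one_le_right (by positivity) (one_le_pow₀ ?_)
    linarith [(n.cast_nonneg : (0 : ℝ) ≤ n)]
  | succ k ih =>
    set x : ℝ := (n : ℝ) + k + 1 with hx
    have hx0 : 0 < x := by positivity
    -- Bernoulli's inequality lets the growing base of the S-th power absorb the summand S.
    have hb : 1 + S * (1 / x) ≤ (1 + 1 / x) ^ S :=
      one_add_mul_le_pow (by have : 0 ≤ 1 / x := by positivity
                             linarith) S
    have hb' : (x + S) * x ^ S ≤ x * (x + 1) ^ S := by
      have e : x + 1 = x * (1 + 1 / x) := by field_simp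
      have e' : x + S = x * (1 + S * (1 / x)) := by field_simp
      rw [e, e', mul_pow]
      nlinarith [mul_le_mul_of_nonneg_left hb (by positivity : 0 ≤ x * x ^ S)]
    have hn : ‖s + 2 * n + k‖ ≤ 2 * (x + S) := by
      refine (norm_add_le _ _).trans ((add_le_add_left (norm_add_le _ _) _).trans ?_)
      simp
      linarith [(n.cast_nonneg : (0 : ℝ) ≤ n), (k.cast_nonneg : (0 : ℝ) ≤ k), (S.cast_nonneg : (0 : ℝ) ≤ S)]
    rw [poch_succ, norm_mul, ← add_assoc, Nat.factorial_succ, pow_succ]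
    push_cast
    rw [← add_assoc, ← hx]
    calc _ = ‖poch (s + 2 * n) k‖ * n.factorial * ‖s + 2 * n + k‖ := by ring
      _ ≤ 2 ^ k * (n + k).factorial * x ^ S * (2 * (x + S)) := by gcongr
      _ = 2 ^ k * (n + k).factorial * 2 * ((x + S) * x ^ S) := by ring
      _ ≤ 2 ^ k * (n + k).factorial * 2 * (x * (x + 1) ^ S) := by gcongr
      _ = _ := by ring

/-- The parameters s+2n over c+n contribute about 2^k to the k-th term, uniformly in n, so 2κ < 1
gives a geometric series with polynomial factors. -/
theorem exists_norm_poch_mul_regHyp_le (β d s c : ℂ) {κ : ℝ} (h0 : 0 ≤ κ) (h1 : κ < 1 / 2) :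
    ∃ K > 0, ∃ A : ℕ, ∀ (n : ℕ) (v : ℂ), ‖v‖ ≤ κ →
      ‖poch β n * regHyp d (s + 2 * n) (c + n) v‖ ≤ K * ((n : ℝ) + 1) ^ A := by
  obtain ⟨S, hS⟩ := exists_nat_ge ‖s‖
  obtain ⟨C₁, hC₁, A₁, h₁⟩ := exists_pow_bound_of_isBigO (binCoeff_isBigO β)
  obtain ⟨C₂, hC₂, A₂, h₂⟩ := exists_pow_bound_of_isBigO (binCoeff_isBigO d)
  obtain ⟨C₃, hC₃, A₃, h₃⟩ := exists_pow_bound_of_isBigO (factorial_mul_inv_Gamma_isBigO c)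
  have hs := (summable_add_one_pow_mul_pow (A₂ + A₃ + S) (r := 2 * κ) (by positivity)
    (by linarith)).mul_left (C₁ * C₂ * C₃)
  have hK : 0 ≤ ∑' k : ℕ, C₁ * C₂ * C₃ * (((k : ℝ) + 1) ^ (A₂ + A₃ + S) * (2 * κ) ^ k) :=
    tsum_nonneg fun k => by positivity
  refine ⟨_, add_pos_of_nonneg_of_pos hK one_pos, A₁ + A₃ + S, fun n v hv => ?_⟩
  have hb : ∀ k : ℕ, ‖poch β n * (poch d k * poch (s + 2 * n) k * (Complex.Gamma (c + n + k))⁻¹ *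
      (v ^ k / (k.factorial : ℂ)))‖ ≤
      ((n : ℝ) + 1) ^ (A₁ + A₃ + S) *
        (C₁ * C₂ * C₃ * (((k : ℝ) + 1) ^ (A₂ + A₃ + S) * (2 * κ) ^ k)) := by
    intro k
    have g1 : (n.factorial : ℂ) ≠ 0 := by exact_mod_cast n.factorial_ne_zero
    have g2 : (k.factorial : ℂ) ≠ 0 := by exact_mod_cast k.factorial_ne_zero
    have g3 : ((n + k).factorial : ℂ) ≠ 0 := by exact_mod_cast (n + k).factorial_ne_zero
    have g4 : (0 : ℝ) < (n + k).factorial := by exact_mod_cast (n + k).factorial_pos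
    have e : poch β n * (poch d k * poch (s + 2 * n) k * (Complex.Gamma (c + n + k))⁻¹ *
        (v ^ k / (k.factorial : ℂ))) = binCoeff β n * binCoeff d k *
        (((n + k).factorial : ℂ) * (Complex.Gamma (c + (n + k : ℕ)))⁻¹) *
        ((poch (s + 2 * n) k * n.factorial) * v ^ k / ((n + k).factorial : ℂ)) := by
      rw [binCoeff, binCoeff]
      push_cast
      rw [add_assoc]
      field_simp
    have hx : (n : ℝ) + k + 1 ≤ (n + 1) * (k + 1) := by
      nlinarith [mul_nonneg (n.cast_nonneg : (0 : ℝ) ≤ n) (k.cast_nonneg : (0 : ℝ) ≤ k)]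
    have h₃' : (n + k).factorial * ‖(Complex.Gamma (c + (n + k : ℕ)))⁻¹‖ ≤
        C₃ * ((n : ℝ) + k + 1) ^ A₃ := by
      have := h₃ (n + k)
      rw [norm_mul, Complex.norm_natCast] at this
      push_cast at this ⊢
      exact this
    rw [e]
    simp only [norm_mul, norm_div, norm_pow, Complex.norm_natCast]
    calc _ ≤ C₁ * ((n : ℝ) + 1) ^ A₁ * (C₂ * ((k : ℝ) + 1) ^ A₂) * (C₃ * ((n : ℝ) + k + 1) ^ A₃) *
          (2 ^ k * (n + k).factorial * ((n : ℝ) + k + 1) ^ S * κ ^ k / (n + k).factorial) := by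
          gcongr ?_ * ?_ * ?_ * (?_ * ?_ ^ _ / _)
          · exact h₁ n
          · exact h₂ k
          · exact norm_poch_two_mul_le hS n k
      _ = C₁ * ((n : ℝ) + 1) ^ A₁ * (C₂ * ((k : ℝ) + 1) ^ A₂) * (C₃ * ((n : ℝ) + k + 1) ^ A₃) *
          (2 ^ k * ((n : ℝ) + k + 1) ^ S * κ ^ k) := by
          field_simp
      _ ≤ C₁ * ((n : ℝ) + 1) ^ A₁ * (C₂ * ((k : ℝ) + 1) ^ A₂) * (C₃ * (((n : ℝ) + 1) * (k + 1)) ^ A₃) *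
          (2 ^ k * (((n : ℝ) + 1) * (k + 1)) ^ S * κ ^ k) := by gcongr
      _ = _ := by
          rw [mul_pow, mul_pow, mul_pow]
          ring
  rw [regHyp, ← tsum_mul_left]
  refine (tsum_of_norm_bounded (hs.mul_left _).hasSum hb).trans ?_
  rw [tsum_mul_left, mul_comm]
  gcongr
  linarith

end

/-! ### Analytic continuation of the Clausen expansion -/

section

open Filter Asymptotics Topology Finset

theorem hasSum_clausen_of_koebe_lt (μ ν : ℂ) {z : ℂ} (hz : 2 * ‖z‖ < ‖1 + z‖)
    (hz' : 4 * ‖z‖ < ‖1 + z‖ ^ 2) :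
    HasSum (fun n => 4 ^ n * clausenPoly n (-ν / 2) (2 * μ) 1 *
        (z ^ n * poch (μ - ν) n * regHyp (2 * μ - ν + 2 * n) (μ - ν + n) (1 + μ + n) (-z)))
      (regHyp (-ν) (μ - ν) (1 + μ) z) := by
  set s := 2 * μ - ν with hs
  let T : ℕ → ℂ → ℂ := fun n w => 4 ^ n * clausenPoly n (-ν / 2) (2 * μ) 1 *
    (w ^ n * poch (μ - ν) n * regHyp (s + 2 * n) (μ - ν + n) (1 + μ + n) (-w))
  -- The Pfaff form of (1+w)^s times the n-th term: its first parameter is 1+ν for every n, and the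
  -- factor (1+w)^{-2n} completes the power of 4w/(1+w)^2.
  let V : ℕ → ℂ → ℂ := fun n w => clausenPoly n (-ν / 2) (2 * μ) 1 * (4 * w / (1 + w) ^ 2) ^ n *
    (poch (μ - ν) n * regHyp (1 + ν) (s + 2 * n) (1 + μ + n) (w / (1 + w)))
  have hTV : ∀ n w, 2 * ‖w‖ < ‖1 + w‖ → V n w = (1 + w) ^ s * T n w := by
    intro n w hw
    have h1 := one_add_ne_zero (norm_lt_one_of_two_mul_lt hw)
    have h2 : (1 + w) ^ s ≠ 0 := by simp [Complex.cpow_eq_zero_iff, h1]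
    simp only [T, V]
    rw [regHyp_comm (s + 2 * n) (μ - ν + n), regHyp_pfaff _ _ _ hw, show 1 + μ + n - (μ - ν + n) = 1 + ν by ring, neg_add,
      Complex.cpow_add _ _ h1, Complex.cpow_neg, Complex.cpow_neg,
      show (2 * n : ℂ) = ((2 * n : ℕ) : ℂ) by push_cast; rfl, Complex.cpow_natCast, pow_mul, div_pow, mul_pow]
    field_simp
  have hpos : 0 < ‖1 + z‖ := (by positivity : 0 ≤ 2 * ‖z‖).trans_lt hz
  obtain ⟨κ, hκ, hκ1⟩ : ∃ κ, ‖z‖ / ‖1 + z‖ < κ ∧ κ < 1 / 2 :=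
    exists_between (by rw [div_lt_iff₀ hpos]; linarith)
  obtain ⟨M, hM, hM1⟩ : ∃ M, 4 * ‖z‖ / ‖1 + z‖ ^ 2 < M ∧ M < 1 :=
    exists_between (by rw [div_lt_one (by positivity)]; exact hz')
  have hκ0 : 0 < κ := (by positivity : 0 ≤ ‖z‖ / ‖1 + z‖).trans_lt hκ
  have hM0 : 0 < M := (by positivity : 0 ≤ 4 * ‖z‖ / ‖1 + z‖ ^ 2).trans_lt hM
  rw [div_lt_iff₀ hpos] at hκ
  rw [div_lt_iff₀ (by positivity)] at hM
  set U : Set ℂ := {z : ℂ | ‖z‖ < κ * ‖1 + z‖} ∩ {z : ℂ | ‖z‖ < 1 ∧ 4 * ‖z‖ < M * ‖1 + z‖ ^ 2}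
  have hU : IsOpen U := by
    refine (isOpen_lt (by fun_prop) (by fun_prop)).inter (IsOpen.and ?_ ?_) <;>
      exact isOpen_lt (by fun_prop) (by fun_prop)
  have h0 : (0 : ℂ) ∈ U := by simp [U, hκ0, hM0]
  have hzU : z ∈ U := ⟨hκ, norm_lt_one_of_two_mul_lt hz, hM⟩
  have hU2 : ∀ w ∈ U, 2 * ‖w‖ < ‖1 + w‖ := fun w hw => by
    have h1 : ‖w‖ < κ * ‖1 + w‖ := hw.1
    have h2 : 0 < ‖1 + w‖ := norm_pos_iff.2 (one_add_ne_zero hw.2.1)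
    nlinarith
  have hc : IsPreconnected U := (((starConvex_norm_lt hκ0 (by linarith)).inter
    (starConvex_koebe_lt hM0)).isPathConnected h0).isConnected.isPreconnected
  obtain ⟨K, hK, A, hKA⟩ := exists_norm_poch_mul_regHyp_le (μ - ν) (1 + ν) s (1 + μ) hκ0.le hκ1
  -- The gap between M and M' absorbs the polynomial factor (n+1)^A.
  obtain ⟨M', hMM', hM'1⟩ := exists_between hM1
  obtain ⟨C, hC, hCb⟩ := exists_norm_mul_pow_le (f := fun k : ℕ => (((k : ℝ) + 1) ^ A : ℝ))
    (p := A) (IsBigO.of_bound 1 (Eventually.of_forall fun k => by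
      rw [Complex.norm_real, Real.rpow_natCast, one_mul])) hM0.le hMM'
  have hbound : ∀ n, ∀ w ∈ U, ‖V n w‖ ≤
      K * C * (‖clausenPoly n (-ν / 2) (2 * μ) 1‖ * M' ^ n) := by
    intro n w hw
    have h1 : 0 < ‖1 + w‖ := norm_pos_iff.2 (one_add_ne_zero hw.2.1)
    have h2 : ‖4 * w / (1 + w) ^ 2‖ ≤ M := by
      rw [norm_div, norm_mul, norm_pow, div_le_iff₀ (by positivity), Complex.norm_ofNat]
      exact hw.2.2.le
    have h3 : ‖w / (1 + w)‖ ≤ κ := by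
      rw [norm_div, div_le_iff₀ h1]
      exact hw.1.le
    have h4 := hCb n
    rw [Complex.norm_real, Real.norm_of_nonneg (by positivity)] at h4
    simp only [V]
    rw [norm_mul, norm_mul, norm_pow]
    calc _ ≤ ‖clausenPoly n (-ν / 2) (2 * μ) 1‖ * M ^ n * (K * ((n : ℝ) + 1) ^ A) := by
          gcongr
          exact hKA n _ h3
      _ = K * ‖clausenPoly n (-ν / 2) (2 * μ) 1‖ * (((n : ℝ) + 1) ^ A * M ^ n) := by ring
      _ ≤ K * ‖clausenPoly n (-ν / 2) (2 * μ) 1‖ * (C * M' ^ n) := by gcongr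
      _ = _ := by ring
  have hsum := (summable_norm_clausenPoly_mul_pow (-ν / 2) (2 * μ) (hM0.trans hMM').le
    hM'1).mul_left (K * C)
  have hVd : DifferentiableOn ℂ (fun w => ∑' n, V n w) U := by
    refine Complex.differentiableOn_tsum_of_summable_norm hsum (fun n w hw => ?_) hU hbound
    have h1 := pow_ne_zero 2 (one_add_ne_zero hw.2.1)
    have h2 := differentiableAt_regHyp_pfaff (1 + ν) (s + 2 * n) (1 + μ + n) (hU2 w hw)
    refine DifferentiableAt.differentiableWithinAt ?_
    simp only [V]
    fun_prop (disch := assumption)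
  have hGd : DifferentiableOn ℂ (fun w => (1 + w) ^ s * regHyp (-ν) (μ - ν) (1 + μ) w) U :=
    fun w hw => ((differentiableAt_one_add_cpow s hw.2.1).mul
      ((differentiableOn_regHyp _ _ _).differentiableAt (Metric.isOpen_ball.mem_nhds
        (mem_ball_zero_iff.2 hw.2.1)))).differentiableWithinAt
  have key : ∑' n, V n z = (1 + z) ^ s * regHyp (-ν) (μ - ν) (1 + μ) z := by
    refine AnalyticOnNhd.eqOn_of_preconnected_of_eventuallyEq (hVd.analyticOnNhd hU)
      (hGd.analyticOnNhd hU) hc h0 ?_ hzU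
    -- Near 0 the double series converges absolutely, and there the identity is already known.
    have h1 : ∀ᶠ w in 𝓝 (0 : ℂ), 4 * ‖w‖ < (1 - ‖w‖) ^ 2 :=
      ContinuousAt.eventually_lt (by fun_prop) (by fun_prop) (by simp)
    filter_upwards [h1, hU.mem_nhds h0] with w hw hwU
    have h2 := (hasSum_clausen_of_lt μ ν hwU.2.1 hw).mul_left ((1 + w) ^ s)
    rw [← h2.tsum_eq]
    exact tsum_congr fun n => hTV n w (hU2 w hwU)
  have hVz : HasSum (fun n => V n z) ((1 + z) ^ s * regHyp (-ν) (μ - ν) (1 + μ) z) :=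
    key ▸ (Summable.of_norm_bounded hsum fun n => hbound n z hzU).hasSum
  have h2 : (1 + z) ^ s ≠ 0 := by
    simp [Complex.cpow_eq_zero_iff, one_add_ne_zero hzU.2.1]
  refine (hasSum_mul_left_iff h2).1 (hVz.congr_fun fun n => ?_)
  exact (hTV n z hz).symm

end

/-! ### Translation to Legendre functions -/

theorem ofReal_cpow_eq_exp {a : ℝ} (ha : 0 < a) (s : ℂ) :
    (a : ℂ) ^ s = Complex.exp (Real.log a * s) := by
  rw [Complex.cpow_def_of_ne_zero (by exact_mod_cast ha.ne'), Complex.ofReal_log ha.le]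

theorem two_cpow_eq_exp (s : ℂ) : (2 : ℂ) ^ s = Complex.exp (Real.log 2 * s) := by
  simpa using ofReal_cpow_eq_exp (a := 2) (by norm_num) s

/-- The argument of the Gauss function in the Legendre function at `1 / x`. -/
noncomputable def legendreArg (x : ℝ) : ℂ := (((1 - x) / (1 + x) : ℝ) : ℂ)

theorem legendreArg_pow {x : ℝ} (hx0 : 0 < x) (hx1 : x < 1) (n : ℕ) :
    legendreArg x ^ n = Complex.exp ((Real.log (1 - x) - Real.log (1 + x)) * n) := by
  have h : 0 < (1 - x) / (1 + x) := div_pos (by linarith) (by linarith)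
  rw [legendreArg, ← Complex.cpow_natCast, ofReal_cpow_eq_exp h,
    Real.log_div (by linarith) (by linarith), Complex.ofReal_sub]

theorem legendreFun_of_lt_one {x : ℝ} (hx0 : 0 < x) (hx1 : x < 1) (ν κ : ℂ) {a b c : ℂ}
    (ha : a = -ν) (hb : b = -κ - ν) (hc : c = 1 - κ) :
    legendreFun ν κ x = Complex.exp (-ν * Real.log 2 - κ / 2 * Real.log (1 - x) +
      (ν + κ / 2) * Real.log (1 + x)) * regHyp a b c (-legendreArg x) := by
  subst ha hb hc
  rw [legendreFun, abs_of_pos (by linarith), two_cpow_eq_exp, ofReal_cpow_eq_exp (by linarith),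
    ofReal_cpow_eq_exp (by linarith), ← Complex.exp_add, ← Complex.exp_add, legendreArg,
    ← Complex.ofReal_neg, ← neg_div, neg_sub, add_comm x]
  congr 2
  ring

theorem legendreFun_one_div {x : ℝ} (hx0 : 0 < x) (hx1 : x < 1) (ν κ : ℂ) {a b c : ℂ}
    (ha : a = -ν) (hb : b = -κ - ν) (hc : c = 1 - κ) :
    legendreFun ν κ (1 / x) = Complex.exp (-ν * Real.log 2 - κ / 2 * Real.log (1 - x) +
      (ν + κ / 2) * Real.log (1 + x) - ν * Real.log x) * regHyp a b c (legendreArg x) := by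
  subst ha hb hc
  have h1 : |1 - 1 / x| = (1 - x) / x := by
    rw [abs_sub_comm, abs_of_pos (by rw [sub_pos, lt_div_iff₀ hx0]; linarith)]
    field_simp
  have h2 : 1 + 1 / x = (1 + x) / x := by field_simp; ring
  have h3 : (1 / x - 1) / (1 / x + 1) = (1 - x) / (1 + x) := by
    rw [add_comm (1 / x), h2]
    field_simp
  rw [legendreFun, h1, h2, h3, two_cpow_eq_exp, ofReal_cpow_eq_exp (div_pos (by linarith) hx0),
    ofReal_cpow_eq_exp (div_pos (by linarith) hx0), Real.log_div (by linarith) hx0.ne',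
    Real.log_div (by linarith) hx0.ne', ← Complex.exp_add, ← Complex.exp_add, legendreArg]
  push_cast
  congr 2
  ring

theorem norm_legendreArg {x : ℝ} (hx0 : 0 < x) (hx1 : x < 1) :
    ‖legendreArg x‖ = (1 - x) / (1 + x) := by
  rw [legendreArg, Complex.norm_of_nonneg (div_nonneg (by linarith) (by linarith))]

theorem norm_legendreArg_lt_one {x : ℝ} (hx0 : 0 < x) (hx1 : x < 1) : ‖legendreArg x‖ < 1 := by
  rw [norm_legendreArg hx0 hx1, div_lt_one] <;> linarith

/-- The sign of 2x^2-1 decides absolute convergence of the Clausen double series; this is where the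
threshold 2^{-1/2} arises. -/
theorem one_sub_sq_norm_legendreArg {x : ℝ} (hx0 : 0 < x) (hx1 : x < 1) :
    (1 - ‖legendreArg x‖) ^ 2 - 4 * ‖legendreArg x‖ = 4 * (2 * x ^ 2 - 1) / (1 + x) ^ 2 := by
  have : 1 + x ≠ 0 := by linarith
  rw [norm_legendreArg hx0 hx1]
  field_simp
  ring

theorem hasSum_clausen_neg_legendreArg {ν μ : ℂ} {x : ℝ} (hx0 : 0 < x) (hx1 : x < 1)
    (h : (√2)⁻¹ < x ∨ (x = (√2)⁻¹ ∧ -(2 / 3) < ν.re) ∨ (∃ k : ℕ, ν - μ = k)) :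
    HasSum (fun n => 4 ^ n * clausenPoly n (-ν / 2) (2 * μ) 1 *
        ((-legendreArg x) ^ n * poch (μ - ν) n *
          regHyp (2 * μ - ν + 2 * n) (μ - ν + n) (1 + μ + n) (-(-legendreArg x))))
      (regHyp (-ν) (μ - ν) (1 + μ) (-legendreArg x)) := by
  have h1 := norm_legendreArg_lt_one hx0 hx1
  have h2 := one_sub_sq_norm_legendreArg hx0 hx1
  have h3 : ((√2)⁻¹) ^ 2 = (1 / 2 : ℝ) := by rw [inv_pow, Real.sq_sqrt (by norm_num)]; norm_num
  rcases h with h | ⟨rfl, h⟩ | ⟨k, h⟩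
  · refine hasSum_clausen_of_lt μ ν (by rwa [norm_neg]) ?_
    have h4 : 1 / 2 < x ^ 2 := by rw [← h3]; gcongr
    have h5 : 0 < 4 * (2 * x ^ 2 - 1) / (1 + x) ^ 2 := div_pos (by linarith) (by positivity)
    rw [norm_neg]
    linarith
  · refine hasSum_clausen_of_eq h (by rwa [norm_neg]) ?_
    rw [h3] at h2
    norm_num at h2 ⊢
    linarith
  · exact hasSum_clausen_of_natCast h _

/-- As y > 0, |1+y| = 1+y, and both conditions for the continuation follow from y < 1: 2y < 1+y and
4y < (1+y)^2. -/
theorem hasSum_clausen_legendreArg (ν μ : ℂ) {x : ℝ} (hx0 : 0 < x) (hx1 : x < 1) :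
    HasSum (fun n => 4 ^ n * clausenPoly n (-ν / 2) (2 * μ) 1 *
        (legendreArg x ^ n * poch (μ - ν) n *
          regHyp (2 * μ - ν + 2 * n) (μ - ν + n) (1 + μ + n) (-legendreArg x)))
      (regHyp (-ν) (μ - ν) (1 + μ) (legendreArg x)) := by
  have h1 := norm_legendreArg_lt_one hx0 hx1
  have h2 : ‖1 + legendreArg x‖ = 1 + ‖legendreArg x‖ := by
    rw [norm_legendreArg hx0 hx1, legendreArg, ← Complex.ofReal_one, ← Complex.ofReal_add,
      Complex.norm_of_nonneg]
    have := div_pos (by linarith : 0 < 1 - x) (by linarith : 0 < 1 + x)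
    linarith
  refine hasSum_clausen_of_koebe_lt μ ν ?_ ?_ <;> rw [h2] <;> nlinarith

theorem ofNat_four_pow_eq_exp (n : ℕ) : (4 : ℂ) ^ n = Complex.exp (2 * Real.log 2 * n) := by
  rw [show (4 : ℂ) ^ n = (2 : ℂ) ^ ((2 * n : ℕ) : ℂ) by
    rw [Complex.cpow_natCast, pow_mul]; norm_num, two_cpow_eq_exp]
  push_cast
  ring_nf

theorem one_sub_sq_cpow_eq_exp {x : ℝ} (hx0 : 0 < x) (hx1 : x < 1) (s : ℂ) :
    ((1 - x ^ 2 : ℝ) : ℂ) ^ s = Complex.exp ((Real.log (1 - x) + Real.log (1 + x)) * s) := by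
  rw [ofReal_cpow_eq_exp (by nlinarith), show 1 - x ^ 2 = (1 - x) * (1 + x) by ring,
    Real.log_mul (by linarith) (by linarith), Complex.ofReal_add]

/-- With every power written as an exponential, matching the prefactors reduces to a linear identity
between exponents. -/
theorem mul_exp_clausen {A B P C D : ℂ} (h : A + B = P + C + D) (p c H : ℂ) :
    p * c * Complex.exp A * (Complex.exp B * H) =
      Complex.exp P * (Complex.exp C * c * (p * Complex.exp D * H)) := by
  have e : Complex.exp A * Complex.exp B = Complex.exp P * Complex.exp C * Complex.exp D := by
    rw [← Complex.exp_add, ← Complex.exp_add, ← Complex.exp_add, h]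
  linear_combination p * c * H * e

theorem mul_exp_bateman {A B E P D : ℂ} (h : A + B - E = P + D) (p g H : ℂ) :
    p * g * (Complex.exp A * (Complex.exp B * H) / Complex.exp E) =
      Complex.exp P * (g * (p * Complex.exp D * H)) := by
  have e : Complex.exp A * Complex.exp B / Complex.exp E = Complex.exp P * Complex.exp D := by
    rw [← Complex.exp_add, ← Complex.exp_sub, ← Complex.exp_add, h]
  linear_combination p * g * H * e

theorem hasSum_of_eq_mul {f g : ℕ → ℂ} {a b P : ℂ} (h : HasSum g b) (hf : ∀ n, f n = P * g n)
    (ha : a = P * b) : HasSum f a := by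
  rw [ha, funext hf]
  exact h.mul_left P

theorem theorem6 (ν μ : ℂ) (x : ℝ) (hx0 : 0 < x) (hx1 : x < 1) :
    -- first pair of series
    (((√2)⁻¹ < x ∨ (x = (√2)⁻¹ ∧ -(2 / 3) < ν.re) ∨ (∃ k : ℕ, ν - μ = k)) →
      HasSum
        (fun n : ℕ =>
          (-1) ^ n * poch (μ - ν) n * clausenPoly n (-ν / 2) (2 * μ) 1 /
              ((2 : ℂ) ^ (μ - n) * (x : ℂ) ^ (n + μ - ν) *
                ((1 - x ^ 2 : ℝ) : ℂ) ^ (-(n : ℂ) / 2)) *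
            legendreFun (ν - μ - n) (-μ - n) (1 / x))
        (legendreFun ν (-μ) x / ((1 + x : ℝ) : ℂ) ^ μ)) ∧
    HasSum
      (fun n : ℕ =>
        (-1) ^ n * poch (μ - ν) n * batemanPoly n ν (-2 * μ) *
          (((1 - x : ℝ) : ℂ) ^ ((n : ℂ) / 2) * legendreFun ν (-μ - n) x /
            ((1 + x : ℝ) : ℂ) ^ ((n : ℂ) / 2 + μ)))
      (legendreFun (ν - μ) (-μ) (1 / x) / ((2 : ℂ) ^ μ * (x : ℂ) ^ (μ - ν))) ∧
    -- second pair of series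
    HasSum
      (fun n : ℕ =>
        poch (μ - ν) n * clausenPoly n (-ν / 2) (2 * μ) 1 /
            ((2 : ℂ) ^ (μ - n) * ((1 - x ^ 2 : ℝ) : ℂ) ^ (-(n : ℂ) / 2)) *
          legendreFun (ν - μ - n) (-n - μ) x)
      ((x : ℂ) ^ ν * legendreFun ν (-μ) (1 / x) / ((1 + x : ℝ) : ℂ) ^ μ) ∧
    HasSum
      (fun n : ℕ =>
        poch (μ - ν) n * batemanPoly n ν (-2 * μ) *
          (((1 - x : ℝ) : ℂ) ^ ((n : ℂ) / 2) * legendreFun ν (-n - μ) (1 / x) /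
            ((1 + x : ℝ) : ℂ) ^ ((n : ℂ) / 2 + μ)))
      (legendreFun (ν - μ) (-μ) x / ((2 : ℂ) ^ μ * (x : ℂ) ^ ν)) ∧
    -- in both pairs the coefficients are inverse to each other
    (∀ n : ℕ,
      (∑ k ∈ Finset.range (n + 1),
          4 ^ k * clausenPoly k (-ν / 2) (2 * μ) 1 * batemanPoly (n - k) ν (-2 * (μ + k)) =
        if n = 0 then 1 else 0) ∧
      (∑ k ∈ Finset.range (n + 1),
          batemanPoly k ν (-2 * μ) *
            (4 ^ (n - k) * clausenPoly (n - k) (-ν / 2) (2 * (μ + k)) 1) =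
        if n = 0 then 1 else 0)) := by
  have h1m : 0 < 1 - x := by linarith
  have h1p : 0 < 1 + x := by linarith
  have hy := norm_legendreArg_lt_one hx0 hx1
  refine ⟨fun hx => ?_, ?_, ?_, ?_, fun n =>
    ⟨sum_clausenPoly_mul_batemanPoly ν μ n, sum_batemanPoly_mul_clausenPoly ν μ n⟩⟩
  -- P is 2^{-ν} (1-x)^{μ/2} (1+x)^{ν-3μ/2}, the prefactor shared by all terms and the sum. It also
  -- serves the next two series; the last one has an additional x^{-ν}.
  · refine hasSum_of_eq_mul
      (P := Complex.exp (-ν * Real.log 2 + μ / 2 * Real.log (1 - x) +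
        (ν - 3 * μ / 2) * Real.log (1 + x)))
      (hasSum_clausen_neg_legendreArg hx0 hx1 hx) (fun n => ?_) ?_
    · rw [legendreFun_one_div hx0 hx1 _ _ (a := μ - ν + n) (b := 2 * μ - ν + 2 * n) (c := 1 + μ + n)
        (by ring) (by ring) (by ring), two_cpow_eq_exp, ofReal_cpow_eq_exp hx0,
        one_sub_sq_cpow_eq_exp hx0 hx1, ofNat_four_pow_eq_exp, neg_neg, neg_pow (legendreArg x),
        mul_right_comm _ (legendreArg x ^ n), legendreArg_pow hx0 hx1, regHyp_comm (μ - ν + n),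
        ← Complex.exp_add, ← Complex.exp_add, div_eq_mul_inv, ← Complex.exp_neg]
      exact mul_exp_clausen (by ring) _ _ _
    · rw [legendreFun_of_lt_one hx0 hx1 _ _ (a := -ν) (b := μ - ν) (c := 1 + μ)
        (by ring) (by ring) (by ring), ofReal_cpow_eq_exp h1p, mul_div_right_comm, ← Complex.exp_sub]
      congr 2
      ring
  · refine hasSum_of_eq_mul
      (P := Complex.exp (-ν * Real.log 2 + μ / 2 * Real.log (1 - x) +
        (ν - 3 * μ / 2) * Real.log (1 + x)))
      (hasSum_bateman μ ν (z := -legendreArg x) (by rwa [norm_neg])) (fun n => ?_) ?_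
    · rw [legendreFun_of_lt_one hx0 hx1 _ _ (a := -ν) (b := μ - ν + n) (c := 1 + μ + n)
        (by ring) (by ring) (by ring), ofReal_cpow_eq_exp h1p, ofReal_cpow_eq_exp h1m,
        neg_pow (legendreArg x), mul_right_comm _ (legendreArg x ^ n), legendreArg_pow hx0 hx1]
      exact mul_exp_bateman (by ring) _ _ _
    · rw [legendreFun_one_div hx0 hx1 _ _ (a := μ - ν) (b := 2 * μ - ν) (c := 1 + μ)
        (by ring) (by ring) (by ring), two_cpow_eq_exp, ofReal_cpow_eq_exp hx0, ← Complex.exp_add,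
        mul_div_right_comm, ← Complex.exp_sub, neg_neg, regHyp_comm]
      congr 2
      ring
  · refine hasSum_of_eq_mul
      (P := Complex.exp (-ν * Real.log 2 + μ / 2 * Real.log (1 - x) +
        (ν - 3 * μ / 2) * Real.log (1 + x)))
      (hasSum_clausen_legendreArg ν μ hx0 hx1) (fun n => ?_) ?_
    · rw [legendreFun_of_lt_one hx0 hx1 _ _ (a := μ - ν + n) (b := 2 * μ - ν + 2 * n)
        (c := 1 + μ + n) (by ring) (by ring) (by ring), two_cpow_eq_exp,
        one_sub_sq_cpow_eq_exp hx0 hx1, ofNat_four_pow_eq_exp, mul_comm (legendreArg x ^ n),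
        legendreArg_pow hx0 hx1, regHyp_comm (μ - ν + n), ← Complex.exp_add, div_eq_mul_inv, ← Complex.exp_neg]
      exact mul_exp_clausen (by ring) _ _ _
    · rw [legendreFun_one_div hx0 hx1 _ _ (a := -ν) (b := μ - ν) (c := 1 + μ)
        (by ring) (by ring) (by ring), ofReal_cpow_eq_exp h1p, ofReal_cpow_eq_exp hx0, ← mul_assoc,
        ← Complex.exp_add, mul_div_right_comm, ← Complex.exp_sub]
      congr 2
      ring
  · refine hasSum_of_eq_mul
      (P := Complex.exp (-ν * Real.log 2 + μ / 2 * Real.log (1 - x) +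
        (ν - 3 * μ / 2) * Real.log (1 + x) -
        ν * Real.log x))
      (hasSum_bateman μ ν hy) (fun n => ?_) ?_
    · rw [legendreFun_one_div hx0 hx1 _ _ (a := -ν) (b := μ - ν + n) (c := 1 + μ + n)
        (by ring) (by ring) (by ring), ofReal_cpow_eq_exp h1p, ofReal_cpow_eq_exp h1m,
        mul_comm (legendreArg x ^ n), legendreArg_pow hx0 hx1]
      exact mul_exp_bateman (by ring) _ _ _
    · rw [legendreFun_of_lt_one hx0 hx1 _ _ (a := μ - ν) (b := 2 * μ - ν) (c := 1 + μ)
        (by ring) (by ring) (by ring), two_cpow_eq_exp, ofReal_cpow_eq_exp hx0, ← Complex.exp_add,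
        mul_div_right_comm, ← Complex.exp_sub, regHyp_comm]
      congr 2
      ring
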